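/- Consider an $M/GI/1/n$ queue ($n\ge 0$ waiting places besides the place in service) with Poisson arrivals of rate $\lambda>0$ and i.i.d. service times, independent of the arrivals, with distribution function $B$, $B(0)=0$. Let $L_n$ be the number of customers lost during a busy period (which starts when a customer arrives at the empty system). Let $\mu,\varepsilon>0$, $E_\mu(x)=1-e^{-\mu x}$, and assume $$B(x)=\tfrac12F(x)+\tfrac12E_\mu(x)\qquad(x\ge 0),$$ where $F$ is the distribution function of a nonnegative random variable $\zeta$ with mean $1/\mu$. For $y\ge0$ with $\Pr\{\zeta>y\}>0$ put $F_y(x)=\Pr\{\zeta\le x+y\mid\zeta>y\}$, and for $y\ge 0$ let $B_y$ be defined from $B$ in the same way. Write $\overline F=1-F$. Suppose that $\sup_{x,y}|F_y(x)-F(x)|<\varepsilon$ (over $x\ge0$ and all $y\ge 0$ with $\Pr\{\zeta>y\}>0$) and that either $\overline F(x+y)\le\overline F(x)\overline F(y)$ for all $x,y\ge0$ (NBU) or $\overline F(x+y)\ge\overline F(x)\overline F(y)$ for all $x,y\ge0$ (NWU). For distribution functions of nonnegative random variables write $\Xi_1\le_{\mathscr C_\lambda}\Xi_2$ if $\int_0^\infty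 e^{-\lambda x}x^i\,\Xi_1(x)\,dx\ge\int_0^\infty e^{-\lambda x}x^i\,\Xi_2(x)\,dx$ for all $i=0,1,2,\dots$. Suppose that for some $y^0\ge0$ with $\Pr\{\zeta>y^0\}>0$ one has $F_{y^0}\le_{\mathscr C_\lambda}F_y$ for all $y\ge0$ with $\Pr\{\zeta>y\}>0$. Put $$\widehat B=\tfrac12\int_0^\infty e^{-\lambda x}\,dF(x)+\tfrac12\,\frac{\mu}{\mu+\lambda},\qquad g^*(z)=\frac{\widehat B}{1-z+z\widehat B}.$$ Then $\sup_{x,y\ge0}|B_y(x)-B(x)|<\tfrac32\varepsilon$, and there is a probability law on $\{0,1,2,\dots\}$ whose generating function $g$ satisfies $$g(z)<\frac{\widehat B}{1-z+z\widehat B}+\frac{3\varepsilon}{2}\cdot\frac{1-z+2z\widehat B}{1-z+z\widehat B}\qquad(0\le z\le1)$$ and, for all complex $z$ with $|z|\le 1$, $$|g(z)-g^*(z)|<\tfrac{3\varepsilon}{2}\,\bigl(1+|z|\,|g^*(z)|\bigr),$$ such that the following holds. Let $Z_n$ be the size of the $n$th generation of the Galton--Watson process with $Z_0=1$ and offspring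 generating function $g$. Let $G$ be any distribution function of a nonnegative random variable with $G\le_{\mathscr C_\lambda}F_{y^0}$ and $G\le_{\mathscr C_\lambda}E_\mu$, and let $\varsigma_1,\varsigma_2,\dots$ be i.i.d., independent of $Z_n$, with $$\Pr\{\varsigma_i=m\}=\int_0^\infty e^{-\lambda x}\frac{(\lambda x)^m}{m!}\,dG(x),\qquad m=0,1,2,\dots.$$ Then $$L_n\ \ge_{st}\ \sum_{i=1}^{Z_n}\varsigma_i .$$ -/

import Mathlib

open MeasureTheory ProbabilityTheory
open scoped NNReal ENNReal

noncomputable section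

namespace LossQueue

/-! ### Distributions -/

/-- Residual distribution function `x ↦ P(ζ ≤ x + y | ζ > y)` of a random variable with law `F`.
It is only used for ages `y` with `P(ζ > y) > 0`, see `Reachable`. -/
def residual (F : Measure ℝ) (y x : ℝ) : ℝ :=
  (ProbabilityTheory.cond F (Set.Ioi y)).real (Set.Iic (x + y))

/-- The ages `y ≥ 0` for which the conditioning event `{ζ > y}` has positive probability. -/
def Reachable (F : Measure ℝ) (y : ℝ) : Prop :=
  0 ≤ y ∧ F (Set.Ioi y) ≠ 0

/-- The distribution function `E_μ(x) = 1 - exp (-μ x)`, `x ≥ 0`, of the exponential law. -/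
def expCdf (mu x : ℝ) : ℝ := 1 - Real.exp (-(mu * x))

/-- The order `Ξ₁ ≤ Ξ₂` in the sense of `𝒞_λ`, for distribution functions on `[0, ∞)`. -/
def LeC (lam : ℝ) (Xi₁ Xi₂ : ℝ → ℝ) : Prop :=
  ∀ i : ℕ, ∫ x in Set.Ioi (0 : ℝ), Real.exp (-(lam * x)) * x ^ i * Xi₂ x
    ≤ ∫ x in Set.Ioi (0 : ℝ), Real.exp (-(lam * x)) * x ^ i * Xi₁ x

/-- New better than used. -/
def NBU (F : Measure ℝ) : Prop :=
  ∀ x y : ℝ, 0 ≤ x → 0 ≤ y → 1 - cdf F (x + y) ≤ (1 - cdf F x) * (1 - cdf F y)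

/-- New worse than used. -/
def NWU (F : Measure ℝ) : Prop :=
  ∀ x y : ℝ, 0 ≤ x → 0 ≤ y → (1 - cdf F x) * (1 - cdf F y) ≤ 1 - cdf F (x + y)

/-- `B = p F + (1 - p) E_μ` is the service time distribution, `B(0) = 0`, where `F` is the law of a
nonnegative random variable with mean `1 / μ` and `sup |F_y(x) - F(x)| < ε`
(the bound `δ` below is any number between the supremum and `ε`). -/
structure ConditionA (B F : Measure ℝ) (p mu eps : ℝ) : Prop where
  p_pos : 0 < p
  p_le_one : p ≤ 1
  eps_pos : 0 < eps
  service_zero : cdf B 0 = 0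
  nonneg : F (Set.Iio 0) = 0
  integrable : Integrable (fun x : ℝ => x) F
  mean : ∫ x, x ∂F = 1 / mu
  repr : ∀ x : ℝ, 0 ≤ x → cdf B x = p * cdf F x + (1 - p) * expCdf mu x
  sup_lt : ∃ δ < eps, ∀ x y : ℝ, 0 ≤ x → Reachable F y → |residual F y x - cdf F x| ≤ δ

/-- Condition A together with: `F` is NBU or NWU. -/
structure ConditionB (B F : Measure ℝ) (p mu eps : ℝ) : Prop
    extends ConditionA B F p mu eps where
  nbu_or_nwu : NBU F ∨ NWU F

/-- `F_{y₀}` is a least element, for `𝒞_λ`, of the family of residual distributions of `F`. -/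
structure ConditionD (F : Measure ℝ) (lam y₀ : ℝ) : Prop where
  reachable : Reachable F y₀
  least : ∀ y : ℝ, Reachable F y → LeC lam (residual F y₀) (residual F y)

/-- `B̂(λ) = p F̂(λ) + (1 - p) μ / (μ + λ)`, with `F̂(λ) = ∫_{[0,∞)} exp (-λ x) dF(x)`. -/
def bHat (F : Measure ℝ) (p mu lam : ℝ) : ℝ :=
  p * (∫ x in Set.Ici (0 : ℝ), Real.exp (-(lam * x)) ∂F) + (1 - p) * (mu / (mu + lam))

/-! ### The queue M/GI/1/n -/

section Queue

variable {Ω : Type*} [MeasurableSpace Ω]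

/-- A Poisson process of rate `lam`, as a counting process on `[0, ∞)`. -/
structure IsPoissonProcess (N : ℝ≥0 → Ω → ℕ) (lam : ℝ) (P : Measure Ω) : Prop where
  measurable : ∀ t, Measurable (N t)
  zero : ∀ ω, N 0 ω = 0
  mono : ∀ ω, Monotone fun t => N t ω
  rightCts : ∀ ω t, ContinuousWithinAt (fun s => N s ω) (Set.Ici t) t
  indepIncrements : HasIndepIncrements N P
  law : ∀ s t : ℝ≥0, s ≤ t →
    HasLaw (fun ω => N t ω - N s ω) (poissonMeasure (lam.toNNReal * (t - s))) P

/-- The random input of a busy period that starts at time `0` with the arrival of a customer at an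
empty system: `N t` is the number of further arrivals in `(0, t]`, a Poisson process of rate `lam`,
and `S 0, S 1, …` are the successive service times, i.i.d. with law `B` and independent of `N`. -/
structure IsMGIInput (N : ℝ≥0 → Ω → ℕ) (S : ℕ → Ω → ℝ) (lam : ℝ) (B : Measure ℝ)
    (P : Measure Ω) : Prop where
  poisson : IsPoissonProcess N lam P
  service_measurable : ∀ k, Measurable (S k)
  service_law : ∀ k, HasLaw (S k) B P
  service_indep : iIndepFun S P
  indep : IndepFun (fun ω t => N t ω) (fun ω k => S k ω) P

/-- The time at which service number `k` begins (while the busy period lasts, the server works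
without interruption), i.e. at which service number `k - 1` ends. -/
def serviceEpoch (S : ℕ → Ω → ℝ) (k : ℕ) (ω : Ω) : ℝ≥0 :=
  (∑ i ∈ Finset.range k, S i ω).toNNReal

/-- Number of customers arriving during service number `k`. -/
def arrivalsDuring (N : ℝ≥0 → Ω → ℕ) (S : ℕ → Ω → ℝ) (ω : Ω) (k : ℕ) : ℕ :=
  N (serviceEpoch S (k + 1) ω) ω - N (serviceEpoch S k ω) ω

/-- Number of customers in the system at the beginning of service number `k`, given the numbers
`a` of arrivals during the successive services; it is `0` once the busy period is over.  There is
room for one customer in service and `n` waiting ones; nobody leaves during a service, and one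
customer leaves at its end. -/
def customers (n : ℕ) (a : ℕ → ℕ) : ℕ → ℕ
  | 0 => 1
  | k + 1 =>
    if customers n a k = 0 then 0 else min (customers n a k + a k) (n + 1) - 1

/-- Number of customers lost during service number `k` of the busy period: those of the `a k`
arrivals that find `n + 1` customers in the system. -/
def lostDuring (n : ℕ) (a : ℕ → ℕ) (k : ℕ) : ℕ :=
  if customers n a k = 0 then 0 else customers n a k + a k - (n + 1)

/-- `L_n`, the number of losses during the busy period. -/
def numLosses (n : ℕ) (N : ℝ≥0 → Ω → ℕ) (S : ℕ → Ω → ℝ) (ω : Ω) : ℕ∞ :=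
  ⨆ K : ℕ, ((∑ k ∈ Finset.range K, lostDuring n (arrivalsDuring N S ω) k : ℕ) : ℕ∞)

/-- `L ≥_st Y`, where `L` is defined on `(Ω, P)` and `Y` has law `q`. -/
def StochGE (P : Measure Ω) (L : Ω → ℕ∞) (q : PMF ℕ) : Prop :=
  ∀ m : ℕ, q.toMeasure (Set.Ici m) ≤ P {ω | (m : ℕ∞) ≤ L ω}

end Queue

/-! ### Branching processes and random sums -/

/-- The law of the sum of `k` independent random variables with law `X`. -/
def iidSum (X : PMF ℕ) : ℕ → PMF ℕ
  | 0 => PMF.pure 0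
  | k + 1 => (iidSum X k).bind fun s => X.map fun x => s + x

/-- The law of `X_1 + ⋯ + X_Z`, where `Z` has law `Z`, the `X_i` are i.i.d. with law `X`, and `Z`
is independent of `(X_i)`. -/
def randomSum (Z X : PMF ℕ) : PMF ℕ := Z.bind (iidSum X)

/-- The law of the size `Z_n` of generation `n` of the Galton–Watson process with `Z_0 = 1` and
offspring law `q`. -/
def galtonWatson (q : PMF ℕ) : ℕ → PMF ℕ
  | 0 => PMF.pure 1
  | n + 1 => randomSum (galtonWatson q n) q

/-- Probability generating function, at real or complex `z` with `|z| ≤ 1`. -/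
def pgf {𝕜 : Type*} [RCLike 𝕜] (q : PMF ℕ) (z : 𝕜) : 𝕜 :=
  ∑' m : ℕ, ((q m).toReal : 𝕜) * z ^ m

/-- `P(ς = m) = ∫_{[0,∞)} exp (-λ x) (λ x)^m / m! dG(x)` for all `m`. -/
def IsMixedPoisson (sig : PMF ℕ) (lam : ℝ) (G : Measure ℝ) : Prop :=
  ∀ m : ℕ, (sig m).toReal =
    ∫ x in Set.Ici (0 : ℝ), Real.exp (-(lam * x)) * (lam * x) ^ m / (m.factorial : ℝ) ∂G

end LossQueue

end

/-! Observed at service completions, the queue is a Markov chain driven by i.i.d. arrival numbers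
with law α = `mixedPoisson lam B`. Its losses split over levels: those incurred until the number of
customers first drops from c + 1 to c, when j = n - c waiting places are free. At the start of a
service with j ≥ 1 there is no such loss if nobody arrives (probability b = B̂). Otherwise the first
arrival opens an excursion one level higher, in the middle of a service, and when it closes a fresh
service starts at the old level. So the level losses are a geometric sum of excursion losses. In the
middle of a service the recursion is the same, except that the chance of one more arrival depends on
the past; it is bounded below by a constant d. Failing with probability 1 - d, and otherwise
continuing geometrically, is the offspring law g(z) = 1 - d + d b z / (1 - z + z b). In a full
system every further arrival is lost, and their number dominates ς. Descending n levels yields the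
random sum over generation n.

Instead of a coupling, expectations of monotone functions under the branching law are shown to be a
subsolution of the transition operator (`tail_mul_expect_stack_le`, `stackValue_le_queueOp`).
Iterating is harmless because the busy period ends almost surely (`queueOp_iterate_mul_busy_le`).

The bounds on α given at least k arrivals (`ConditionA.tail_mul_le`) hold because a service sees k +
1 arrivals exactly when it outlasts an Erlang time, Erlang densities convolve, and a residual of B
mixes a residual of F, bounded through F_{y₀}, with E_μ. This gives d = min(∫ λ e^{-λx} (1 -
F_{y₀}(x)) dx, λ/(λ+μ)).

Finally g - g* = (1 - d - b)(1 - z g*), so the analytic claims reduce to |1 - d - b| < 3ε/2. That,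
like the bound on B_y - B, rests on F being uniformly close to E_μ (`abs_cdf_sub_expCdf_le`), proved
through the equilibrium law of F. -/

namespace LossQueue

/-- The expectation of `f` under the probability mass function `p`. -/
noncomputable def expect {ι : Type*} (p : PMF ι) (f : ι → ℝ≥0∞) : ℝ≥0∞ := ∑' k, p k * f k

/-! ### Calculus of expectations under discrete laws -/

section Expect

variable {ι κ : Type*}

theorem expect_mono (p : PMF ι) {f g : ι → ℝ≥0∞} (h : ∀ k, f k ≤ g k) :
    expect p f ≤ expect p g :=
  ENNReal.tsum_le_tsum fun k => mul_le_mul_right (h k) _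

theorem expect_const (p : PMF ι) (c : ℝ≥0∞) : expect p (fun _ => c) = c := by
  rw [expect, ENNReal.tsum_mul_right, p.tsum_coe, one_mul]

theorem expect_add (p : PMF ι) (f g : ι → ℝ≥0∞) :
    expect p (fun k => f k + g k) = expect p f + expect p g := by
  simp only [expect, mul_add, ENNReal.tsum_add]

theorem expect_const_mul (p : PMF ι) (c : ℝ≥0∞) (f : ι → ℝ≥0∞) :
    expect p (fun k => c * f k) = c * expect p f := by
  simp only [expect, ← ENNReal.tsum_mul_left, mul_left_comm]

theorem expect_pure (a : ι) (f : ι → ℝ≥0∞) : expect (PMF.pure a) f = f a := by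
  rw [expect, tsum_eq_single a]
  · simp
  · intro b hb
    simp [PMF.pure_apply, hb]

theorem expect_bind (p : PMF ι) (q : ι → PMF κ) (f : κ → ℝ≥0∞) :
    expect (p.bind q) f = expect p fun a => expect (q a) f := by
  simp only [expect, PMF.bind_apply, ← ENNReal.tsum_mul_right, ← ENNReal.tsum_mul_left]
  rw [ENNReal.tsum_comm]
  simp only [mul_assoc]

theorem expect_map (p : PMF ι) (g : ι → κ) (f : κ → ℝ≥0∞) :
    expect (p.map g) f = expect p fun a => f (g a) := by
  rw [PMF.map, expect_bind]
  simp only [Function.comp, expect_pure]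

theorem expect_comm (p : PMF ι) (q : PMF κ) (f : ι → κ → ℝ≥0∞) :
    (expect p fun a => expect q fun b => f a b) = expect q fun b => expect p fun a => f a b := by
  simp only [expect, ← ENNReal.tsum_mul_left]
  rw [ENNReal.tsum_comm]
  simp only [mul_left_comm]

theorem expect_indicator (p : PMF ℕ) (s : Set ℕ) :
    expect p (s.indicator 1) = p.toMeasure s := by
  rw [PMF.toMeasure_apply (hs := .of_discrete), expect]
  refine tsum_congr fun k => ?_
  by_cases hk : k ∈ s <;> simp [hk]

end Expect

/-! ### Random sums and branching -/

section Sums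

variable (X Z q : PMF ℕ) (f : ℕ → ℝ≥0∞)

theorem expect_iidSum_zero : expect (iidSum X 0) f = f 0 := expect_pure 0 f

theorem expect_iidSum_succ (k : ℕ) :
    expect (iidSum X (k + 1)) f = expect (iidSum X k) fun s => expect X fun x => f (s + x) := by
  rw [iidSum, expect_bind]
  simp only [expect_map]

theorem expect_iidSum_add (j k : ℕ) :
    expect (iidSum X (j + k)) f =
      expect (iidSum X j) fun s => expect (iidSum X k) fun t => f (s + t) := by
  induction k generalizing f with
  | zero => simp [expect_iidSum_zero]
  | succ k ih =>
    rw [← add_assoc, expect_iidSum_succ, ih]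
    simp only [expect_iidSum_succ, add_assoc]

theorem expect_randomSum :
    expect (randomSum Z X) f = expect Z fun k => expect (iidSum X k) f :=
  expect_bind _ _ _

theorem expect_iidSum_one : expect (iidSum X 1) f = expect X f := by
  rw [expect_iidSum_succ, expect_iidSum_zero]
  simp

/-- Independent random sums concatenate: only the total number of summands matters, and it is itself
an i.i.d. sum. -/
theorem expect_iidSum_randomSum (k : ℕ) :
    expect (iidSum (randomSum q X) k) f = expect (iidSum q k) fun j => expect (iidSum X j) f := by
  induction k generalizing f with
  | zero => simp [expect_iidSum_zero]
  | succ k ih =>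
    rw [expect_iidSum_succ, expect_iidSum_succ, ih]
    simp only [expect_randomSum, expect_iidSum_add]
    congr 1
    funext j
    rw [expect_comm]

/-- Absorbing the last generation into the summand law turns the forward recursion for
`galtonWatson` into iteration of `randomSum q`, the form that matches the descent through the levels
of the queue. -/
theorem expect_galtonWatson (n : ℕ) :
    expect (randomSum (galtonWatson q n) X) f = expect ((randomSum q)^[n] X) f := by
  induction n generalizing X with
  | zero => rw [galtonWatson, expect_randomSum, expect_pure, expect_iidSum_one]; rfl
  | succ n ih =>
    rw [Function.iterate_succ_apply, ← ih, galtonWatson]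
    simp only [expect_randomSum, expect_iidSum_randomSum]

end Sums

/-- If the tail sums of `u` are dominated by those of `v`, then so are the integrals of monotone
functions. -/
theorem tsum_mul_le_of_tail_le {u v : ℕ → ℝ≥0∞} (h : ∀ m, ∑' r, u (m + r) ≤ ∑' r, v (m + r))
    {g : ℕ → ℝ≥0∞} (hg : Monotone g) : ∑' r, u r * g r ≤ ∑' r, v r * g r := by
  -- Summation by parts: g is g 0 plus its nonnegative increments, so each sum against g is a
  -- positive combination of tail sums.
  have hsum : ∀ r, g r = g 0 + ∑' m, if m < r then g (m + 1) - g m else 0 := by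
    intro r
    rw [tsum_eq_sum (s := Finset.range r) (by intro b hb; simp at hb; simp [hb]),
      Finset.sum_congr rfl (g := fun m => g (m + 1) - g m)
        (fun m hm => if_pos (Finset.mem_range.1 hm))]
    induction r with
    | zero => simp
    | succ r ih =>
      rw [Finset.sum_range_succ, ← add_assoc, ← ih, add_tsub_cancel_of_le (hg (Nat.le_succ r))]
  have hrep : ∀ w : ℕ → ℝ≥0∞, ∑' r, w r * g r =
      (∑' r, w (0 + r)) * g 0 + ∑' m, (∑' r, w (m + 1 + r)) * (g (m + 1) - g m) := by
    intro w
    have h1 : ∀ r, w r * g r =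
        w r * g 0 + ∑' m, if m < r then w r * (g (m + 1) - g m) else 0 := by
      intro r
      rw [hsum r, mul_add, ← ENNReal.tsum_mul_left]
      simp only [mul_ite, mul_zero]
    rw [tsum_congr h1, ENNReal.tsum_add, ENNReal.tsum_mul_right, ENNReal.tsum_comm]
    simp only [zero_add]
    congr 1
    refine tsum_congr fun m => ?_
    rw [← ENNReal.tsum_mul_right,
      ← (Summable.sum_add_tsum_nat_add' (k := m + 1) ENNReal.summable),
      Finset.sum_eq_zero, zero_add]
    · refine tsum_congr fun r => ?_
      rw [if_pos (by omega), add_comm r]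
    · intro i hi
      rw [if_neg]
      simp at hi
      omega
  rw [hrep u, hrep v]
  exact add_le_add (mul_le_mul_left (h 0) _)
    (ENNReal.tsum_le_tsum fun m => mul_le_mul_left (h (m + 1)) _)

/-! ### The transition operator of customers and losses -/

/-- The number of customers at the beginning of a service together with the number of losses so
far, after one more service with `a` arrivals. -/
def queueStep (n : ℕ) (x : ℕ × ℕ) (a : ℕ) : ℕ × ℕ :=
  if x.1 = 0 then x else (min (x.1 + a) (n + 1) - 1, x.2 + (x.1 + a - (n + 1)))

/-- The transition operator of the chain of customers and losses, with arrival law `α`. -/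
noncomputable def queueOp (n : ℕ) (α : PMF ℕ) (ψ : ℕ × ℕ → ℝ≥0∞) (x : ℕ × ℕ) : ℝ≥0∞ :=
  expect α fun a => ψ (queueStep n x a)

theorem queueOp_zero (n : ℕ) (α : PMF ℕ) (ψ : ℕ × ℕ → ℝ≥0∞) (s : ℕ) :
    queueOp n α ψ (0, s) = ψ (0, s) := by
  simp [queueOp, queueStep, expect_const]

theorem queueOp_add (n : ℕ) (α : PMF ℕ) (ψ φ : ℕ × ℕ → ℝ≥0∞) :
    queueOp n α (ψ + φ) = queueOp n α ψ + queueOp n α φ := by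
  funext x
  simp [queueOp, expect_add]

theorem queueOp_iterate_add (n : ℕ) (α : PMF ℕ) (K : ℕ) (ψ φ : ℕ × ℕ → ℝ≥0∞) :
    (queueOp n α)^[K] (ψ + φ) = (queueOp n α)^[K] ψ + (queueOp n α)^[K] φ := by
  induction K generalizing ψ φ with
  | zero => rfl
  | succ K ih => simp only [Function.iterate_succ_apply, queueOp_add, ih]

theorem queueOp_const_mul (n : ℕ) (α : PMF ℕ) (C : ℝ≥0∞) (ψ : ℕ × ℕ → ℝ≥0∞) :
    queueOp n α (fun x => C * ψ x) = fun x => C * queueOp n α ψ x := by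
  funext x
  simp [queueOp, expect_const_mul]

theorem queueOp_iterate_const_mul (n : ℕ) (α : PMF ℕ) (K : ℕ) (C : ℝ≥0∞) (ψ : ℕ × ℕ → ℝ≥0∞) :
    (queueOp n α)^[K] (fun x => C * ψ x) = fun x => C * (queueOp n α)^[K] ψ x := by
  induction K generalizing ψ with
  | zero => rfl
  | succ K ih => simp only [Function.iterate_succ_apply, queueOp_const_mul, ih]

/-! ### The branching value as a subsolution -/

section Subsolution

variable (n : ℕ) (q geo sig : PMF ℕ)

/-- The law of the losses attached to a particle `j` levels below capacity which is at the
beginning of a fresh service. -/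
noncomputable def freshLaw : ℕ → PMF ℕ
  | 0 => sig
  | j + 1 => randomSum geo ((randomSum q)^[j] sig)

/-- The law of the sum of independent fresh losses at the top `c` customers levels. -/
noncomputable def stackLaw : ℕ → PMF ℕ
  | 0 => PMF.pure 0
  | c + 1 => (stackLaw c).bind fun s => (freshLaw q geo sig (n - c)).map fun x => s + x

theorem expect_stackLaw_zero (f : ℕ → ℝ≥0∞) : expect (stackLaw n q geo sig 0) f = f 0 :=
  expect_pure 0 f

theorem expect_stackLaw_succ (c : ℕ) (f : ℕ → ℝ≥0∞) :
    expect (stackLaw n q geo sig (c + 1)) f =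
      expect (stackLaw n q geo sig c) fun s =>
        expect (freshLaw q geo sig (n - c)) fun x => f (s + x) := by
  rw [stackLaw, expect_bind]
  simp only [expect_map]

/-- The value function of the comparison system. -/
noncomputable def stackValue (f : ℕ → ℝ≥0∞) (x : ℕ × ℕ) : ℝ≥0∞ :=
  expect (stackLaw n q geo sig x.1) fun t => f (x.2 + t)

variable {n q geo sig}

/-- If Z vanishes with weight b and is otherwise 1 + Z', its random sum is zero or one summand plus
an independent sum over Z'. Both `q` and `geo` have this form, with Z' = `geo`. -/
theorem expect_randomSum_of_shift {Z Z' X : PMF ℕ} {b d : ℝ≥0∞}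
    (hZ : ∀ f, expect Z f = b * f 0 + d * expect Z' fun k => f (k + 1)) (f : ℕ → ℝ≥0∞) :
    expect (randomSum Z X) f =
      b * f 0 + d * expect (randomSum Z' X) fun s => expect X fun x => f (s + x) := by
  rw [expect_randomSum, hZ, expect_iidSum_zero, expect_randomSum]
  simp only [expect_iidSum_succ]

variable {α : PMF ℕ} {β b d b' : ℝ≥0∞}
  (hq : ∀ f, expect q f = β * f 0 + d * expect geo fun k => f (k + 1))
  (hgeo : ∀ f, expect geo f = b * f 0 + b' * expect geo fun k => f (k + 1))
  (hβ : β + d = 1)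
  (hsig : ∀ k m, (∑' r, α (k + r)) * ∑' r, sig (m + r) ≤ ∑' r, α (k + (m + r)))
  (hd : ∀ k, (∑' r, α (k + r)) * d ≤ ∑' r, α (k + 1 + r))

include hsig in
theorem tail_mul_expect_le (k : ℕ) {g : ℕ → ℝ≥0∞} (hg : Monotone g) :
    (∑' r, α (k + r)) * expect sig g ≤ ∑' r, α (k + r) * g r := by
  have := tsum_mul_le_of_tail_le (u := fun r => (∑' r, α (k + r)) * sig r)
    (v := fun r => α (k + r)) (fun m => by rw [ENNReal.tsum_mul_left]; exact hsig k m) hg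
  simpa only [expect, ← ENNReal.tsum_mul_left, mul_assoc] using this

include hq hβ hsig hd in
-- A service has already seen k arrivals, c + 1 customers are present and j places are free. The
-- iterate `(randomSum q)^[j] sig` undercounts the losses until the level falls to c, and the stack
-- covers the c customers below. Multiplying by P(α ≥ k) avoids conditioning. The induction on j
-- waits for the next arrival, which uses up one free place.
theorem tail_mul_expect_stack_le {f : ℕ → ℝ≥0∞} (hf : Monotone f) (j : ℕ) :
    ∀ k c s : ℕ, c + j = n →
      (∑' r, α (k + r)) * (expect (stackLaw n q geo sig c) fun t =>
          expect ((randomSum q)^[j] sig) fun y => f (s + (t + y))) ≤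
        ∑' r, α (k + r) * stackValue n q geo sig f
          (min (c + 1 + r) (n + 1) - 1, s + (c + 1 + r - (n + 1))) := by
  induction j with
  | zero =>
    -- No free place: all further arrivals are lost, and `hsig` compares their number with `sig`.
    intro k c s hc
    obtain rfl : c = n := by omega
    rw [expect_comm]
    refine (tail_mul_expect_le hsig k ?_).trans (ENNReal.tsum_le_tsum fun r => ?_)
    · exact fun x y h => expect_mono _ fun _ => hf (by omega)
    · rw [stackValue]
      have h1 : min (c + 1 + r) (c + 1) - 1 = c := by omega
      have h2 : c + 1 + r - (c + 1) = r := by omega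
      simp only [h1, h2]
      refine mul_le_mul_right (expect_mono _ fun t => hf (by omega)) _
  | succ j ih =>
    intro k c s hc
    -- u is the value if the service ends without another arrival, v the bound if one more customer
    -- comes in.
    set u := expect (stackLaw n q geo sig c) fun t => f (s + t) with hu
    set v := expect (stackLaw n q geo sig (c + 1)) fun t =>
          expect ((randomSum q)^[j] sig) fun y => f (s + (t + y)) with hv
    have huv : u ≤ v := by
      rw [hu, hv, expect_stackLaw_succ]
      refine expect_mono _ fun t => ?_
      refine le_trans (expect_const (freshLaw q geo sig (n - c)) _).ge (expect_mono _ fun x => ?_)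
      refine le_trans (expect_const ((randomSum q)^[j] sig) _).ge (expect_mono _ fun y => ?_)
      exact hf (by omega)
    have hL : (expect (stackLaw n q geo sig c) fun t =>
          expect ((randomSum q)^[j + 1] sig) fun y => f (s + (t + y))) = β * u + d * v := by
      rw [hu, hv, expect_stackLaw_succ, ← expect_const_mul, ← expect_const_mul, ← expect_add]
      have hnc : n - c = j + 1 := by omega
      simp only [Function.iterate_succ_apply', hnc, freshLaw, expect_randomSum_of_shift hq, add_zero,
        add_assoc]
    have hR : α k * u + (∑' r, α (k + 1 + r)) * v ≤
        ∑' r, α (k + r) * stackValue n q geo sig f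
          (min (c + 1 + r) (n + 1) - 1, s + (c + 1 + r - (n + 1))) := by
      refine le_trans ?_ (tsum_eq_zero_add' ENNReal.summable).ge
      refine add_le_add (le_of_eq ?_) ((ih (k + 1) (c + 1) s (by omega)).trans (le_of_eq ?_))
      · have h1 : min (c + 1 + 0) (n + 1) - 1 = c := by omega
        have h2 : s + (c + 1 + 0 - (n + 1)) = s := by omega
        simp only [h1, h2, stackValue, hu, add_zero]
      · refine tsum_congr fun r => ?_
        have h1 : k + 1 + r = k + (r + 1) := by omega
        have h2 : c + 1 + 1 + r = c + 1 + (r + 1) := by omega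
        simp only [h1, h2]
    rw [hL]
    refine le_trans ?_ hR
    have hA : ∑' r, α (k + r) = α k + ∑' r, α (k + 1 + r) := by
      rw [tsum_eq_zero_add' ENNReal.summable]
      congr 1
      refine tsum_congr fun r => ?_
      rw [show k + 1 + r = k + (r + 1) by omega]
    have hAle : ∑' r, α (k + r) ≤ 1 := by
      rw [← α.tsum_coe]
      exact ENNReal.tsum_comp_le_tsum_of_injective (add_right_injective k) _
    set A := ∑' r, α (k + r)
    set A' := ∑' r, α (k + 1 + r)
    have hA'le : A' ≤ 1 := le_trans (by rw [hA]; exact le_add_self) hAle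
    have hAβ : A * β + A * d = α k + A' := by rw [← mul_add, hβ, mul_one, hA]
    -- The excess e of P(α ≥ k + 1) over P(α ≥ k) d is weight that the branching system puts on u
    -- and the queue on v ≥ u.
    obtain ⟨e, he⟩ := exists_add_of_le (hd k)
    have heA : A * β = α k + e := by
      have hfin : A * d ≠ ∞ := ne_top_of_le_ne_top (by simp) ((hd k).trans hA'le)
      have : A * d + A * β = A * d + (α k + e) := by
        rw [add_comm, hAβ]
        show α k + A' = _
        rw [show A' = A * d + e from he]
        ring
      exact (ENNReal.add_right_inj hfin).1 this
    calc A * (β * u + d * v) = α k * u + e * u + A * d * v := by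
          rw [mul_add, ← mul_assoc, heA]; ring
      _ ≤ α k * u + e * v + A * d * v := by gcongr
      _ = α k * u + A' * v := by rw [show A' = A * d + e from he]; ring

include hq hβ hsig hd hgeo in
-- At a fresh service the probabilities b and 1 - b of no arrival and of some arrival are exact,
-- whence the geometric law; only what follows the first arrival is estimated.
theorem stackValue_le_queueOp (hb : b = α 0) (hb' : b' = ∑' r, α (1 + r))
    {f : ℕ → ℝ≥0∞} (hf : Monotone f) (c s : ℕ)
    (hc : c ≤ n) :
    stackValue n q geo sig f (c + 1, s) ≤ queueOp n α (stackValue n q geo sig f) (c + 1, s) := by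
  have hop : queueOp n α (stackValue n q geo sig f) (c + 1, s) =
      ∑' r, α (0 + r) * stackValue n q geo sig f
          (min (c + 1 + r) (n + 1) - 1, s + (c + 1 + r - (n + 1))) := by
    simp [queueOp, queueStep, expect]
  rw [hop]
  obtain ⟨j, rfl⟩ := Nat.exists_eq_add_of_le hc
  -- In a full system the preceding bound applies with k = 0. Otherwise the case of no arrival is
  -- split off and it applies with k = 1, one level higher.
  rcases j with _ | j
  · refine le_trans (le_of_eq ?_)
      (tail_mul_expect_stack_le hq hβ hsig hd hf 0 0 c s (by omega))
    simp only [zero_add, α.tsum_coe, one_mul, stackValue, expect_stackLaw_succ]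
    simp [freshLaw]
  · rw [tsum_eq_zero_add' ENNReal.summable]
    have h2 := tail_mul_expect_stack_le (n := c + (j + 1)) (geo := geo)
      hq hβ hsig hd hf j 1 (c + 1) s (by omega)
    have h3 : ∑' r, α (0 + (r + 1)) * stackValue (c + (j + 1)) q geo sig f
          (min (c + 1 + (r + 1)) (c + (j + 1) + 1) - 1, s + (c + 1 + (r + 1) - (c + (j + 1) + 1)))
        = ∑' r, α (1 + r) * stackValue (c + (j + 1)) q geo sig f
          (min (c + 1 + 1 + r) (c + (j + 1) + 1) - 1, s + (c + 1 + 1 + r - (c + (j + 1) + 1))) := by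
      refine tsum_congr fun r => ?_
      have h1 : 0 + (r + 1) = 1 + r := by omega
      have h2 : c + 1 + (r + 1) = c + 1 + 1 + r := by omega
      simp only [h1, h2]
    rw [h3]
    refine le_trans (le_of_eq ?_) (add_le_add_right h2 _)
    have h4 : min (c + 1 + 0) (c + (j + 1) + 1) - 1 = c := by omega
    have h5 : s + (c + 1 + 0 - (c + (j + 1) + 1)) = s := by omega
    have hnc : c + (j + 1) - c = j + 1 := by omega
    rw [← hb', h4, h5, add_zero, ← hb]
    simp only [stackValue, expect_stackLaw_succ, hnc, freshLaw]
    rw [← expect_const_mul, ← expect_const_mul, ← expect_add]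
    congr 1
    funext t
    rw [expect_randomSum_of_shift hgeo]
    simp only [add_zero, add_assoc]

end Subsolution

/-! ### Iterating the operator and the end of the busy period -/

section Chain

variable {n : ℕ} {α : PMF ℕ}

theorem queueStep_fst_le {x : ℕ × ℕ} (hx : x.1 ≤ n + 1) (a : ℕ) : (queueStep n x a).1 ≤ n + 1 := by
  unfold queueStep
  split_ifs
  · exact hx
  · dsimp only
    omega

theorem queueOp_iterate_le {ψ φ : ℕ × ℕ → ℝ≥0∞} (h : ∀ x : ℕ × ℕ, x.1 ≤ n + 1 → ψ x ≤ φ x) (K : ℕ) :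
    ∀ x : ℕ × ℕ, x.1 ≤ n + 1 → (queueOp n α)^[K] ψ x ≤ (queueOp n α)^[K] φ x := by
  induction K with
  | zero => exact h
  | succ K ih =>
    intro x hx
    rw [Function.iterate_succ_apply', Function.iterate_succ_apply']
    exact expect_mono _ fun a => ih _ (queueStep_fst_le hx a)

theorem le_queueOp_iterate {ψ : ℕ × ℕ → ℝ≥0∞}
    (h : ∀ x : ℕ × ℕ, x.1 ≤ n + 1 → ψ x ≤ queueOp n α ψ x) (K : ℕ) :
    ∀ x : ℕ × ℕ, x.1 ≤ n + 1 → ψ x ≤ (queueOp n α)^[K] ψ x := by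
  induction K with
  | zero => exact fun _ _ => le_rfl
  | succ K ih =>
    intro x hx
    rw [Function.iterate_succ_apply']
    exact (h x hx).trans (expect_mono _ fun a => ih _ (queueStep_fst_le hx a))

/-- The indicator that the busy period is not over. -/
def busy (x : ℕ × ℕ) : ℝ≥0∞ := if x.1 = 0 then 0 else 1

theorem queueOp_iterate_zero (ψ : ℕ × ℕ → ℝ≥0∞) (s K : ℕ) :
    (queueOp n α)^[K] ψ (0, s) = ψ (0, s) := by
  induction K generalizing ψ with
  | zero => rfl
  | succ K ih => rw [Function.iterate_succ_apply, ih, queueOp_zero]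

theorem queueOp_iterate_busy_le_one (K : ℕ) (x : ℕ × ℕ) : (queueOp n α)^[K] busy x ≤ 1 := by
  induction K generalizing x with
  | zero => simp only [Function.iterate_zero, id, busy]; split_ifs <;> simp
  | succ K ih =>
    rw [Function.iterate_succ_apply']
    exact (expect_mono _ fun a => ih _).trans (expect_const _ _).le

/-- From c customers, c consecutive services without arrivals empty the system, and an empty system
stays empty. -/
theorem queueOp_iterate_busy_add_pow_le (c : ℕ) :
    ∀ K s : ℕ, c ≤ K → c ≤ n + 1 → (queueOp n α)^[K] busy (c, s) + α 0 ^ c ≤ 1 := by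
  induction c with
  | zero =>
    intro K s _ _
    simp [queueOp_iterate_zero, busy]
  | succ c ih =>
    intro K s hK hc
    obtain ⟨K, rfl⟩ := Nat.exists_eq_add_of_le' (Nat.one_le_of_lt hK)
    rw [Function.iterate_succ_apply', queueOp, expect, tsum_eq_zero_add' ENNReal.summable]
    have h1 : queueStep n (c + 1, s) 0 = (c, s) := by
      simp only [queueStep, Nat.succ_ne_zero, if_false, add_zero, Prod.mk.injEq]
      omega
    rw [h1]
    calc α 0 * (queueOp n α)^[K] busy (c, s) +
          ∑' a, α (a + 1) * (queueOp n α)^[K] busy (queueStep n (c + 1, s) (a + 1)) +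
          α 0 ^ (c + 1)
        ≤ α 0 * (queueOp n α)^[K] busy (c, s) + ∑' a, α (a + 1) * 1 + α 0 ^ (c + 1) := by
          gcongr
          exact queueOp_iterate_busy_le_one _ _
      _ = α 0 * ((queueOp n α)^[K] busy (c, s) + α 0 ^ c) + ∑' a, α (a + 1) := by
          simp only [mul_one]; ring
      _ ≤ α 0 * 1 + ∑' a, α (a + 1) := by
          gcongr
          exact ih K s (by omega) (by omega)
      _ = 1 := by rw [mul_one, ← tsum_eq_zero_add' ENNReal.summable, α.tsum_coe]

theorem queueOp_iterate_busy_le (x : ℕ × ℕ) (hx : x.1 ≤ n + 1) :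
    (queueOp n α)^[n + 1] busy x ≤ (1 - α 0 ^ (n + 1)) * busy x := by
  obtain ⟨c, s⟩ := x
  rcases Nat.eq_zero_or_pos c with rfl | hc
  · simp [queueOp_iterate_zero, busy]
  · rw [busy, if_neg hc.ne', mul_one]
    have hpow : ∀ k, α 0 ^ k ≤ 1 := fun k => pow_le_one₀ (zero_le) (α.coe_le_one 0)
    refine ENNReal.le_sub_of_add_le_right (ne_top_of_le_ne_top ENNReal.one_ne_top (hpow _)) ?_
    refine le_trans (add_le_add_right ?_ _)
      (queueOp_iterate_busy_add_pow_le (α := α) c (n + 1) s hx hx)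
    exact pow_le_pow_of_le_one (zero_le) (α.coe_le_one 0) hx

/-- Each block of n + 1 services ends the busy period with probability at least α(0)^(n+1), whatever
the state at its start. -/
theorem queueOp_iterate_mul_busy_le (j : ℕ) (x : ℕ × ℕ) (hx : x.1 ≤ n + 1) :
    (queueOp n α)^[(n + 1) * j] busy x ≤ (1 - α 0 ^ (n + 1)) ^ j * busy x := by
  induction j generalizing x with
  | zero => simp
  | succ j ih =>
    rw [Nat.mul_succ, add_comm, Function.iterate_add_apply]
    refine (queueOp_iterate_le ih _ x hx).trans ?_
    rw [queueOp_iterate_const_mul, pow_succ _ j, mul_assoc]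
    exact mul_le_mul_right (queueOp_iterate_busy_le x hx) _

end Chain

/-! ### Comparison of tails -/

section Comparison

variable {n : ℕ} {α q geo sig : PMF ℕ} {β b d b' : ℝ≥0∞}

/-- The tail of the losses in the branching system is at most the tail of the losses of the chain,
up to the probability that the busy period lasts for more than `K` services. -/
theorem toMeasure_Ici_le_queueOp
    (hq : ∀ f, expect q f = β * f 0 + d * expect geo fun k => f (k + 1))
    (hgeo : ∀ f, expect geo f = b * f 0 + b' * expect geo fun k => f (k + 1))
    (hβ : β + d = 1)
    (hsig : ∀ k m, (∑' r, α (k + r)) * ∑' r, sig (m + r) ≤ ∑' r, α (k + (m + r)))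
    (hd : ∀ k, (∑' r, α (k + r)) * d ≤ ∑' r, α (k + 1 + r))
    (hb : b = α 0) (hb' : b' = ∑' r, α (1 + r)) (m K : ℕ) :
    (randomSum (galtonWatson q n) sig).toMeasure (Set.Ici m) ≤
      (queueOp n α)^[K] (fun x => (Set.Ici m).indicator 1 x.2) (1, 0) +
        (queueOp n α)^[K] busy (1, 0) := by
  set f : ℕ → ℝ≥0∞ := (Set.Ici m).indicator 1 with hf
  have hmono : Monotone f := by
    intro x y hxy
    by_cases hx : m ≤ x
    · simp [hf, hx, hx.trans hxy]
    · simp [hf, hx]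
  have hf1 : ∀ x, f x ≤ 1 := fun x => Set.indicator_le_self' (by simp) x
  have hA0 : ∑' r, α (0 + r) = 1 := by simp [α.tsum_coe]
  have hbb : b + b' = 1 := by
    rw [hb, hb', ← α.tsum_coe, tsum_eq_zero_add' (f := α) ENNReal.summable]
    simp [add_comm]
  have hdb : d ≤ b' := by
    have := hd 0
    rwa [hA0, one_mul, zero_add, ← hb'] at this
  -- The busy period begins with a fresh service, so replacing `geo` by `q` at the top level loses
  -- something: `q` gives less weight to being positive, since d ≤ 1 - b.
  have h1 : expect ((randomSum q)^[n] sig) f ≤ expect (freshLaw q geo sig n) f := by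
    cases n with
    | zero => exact le_rfl
    | succ n =>
      rw [Function.iterate_succ_apply', freshLaw, expect_randomSum_of_shift hq,
        expect_randomSum_of_shift hgeo f]
      set V := expect (randomSum geo ((randomSum q)^[n] sig)) fun s =>
        expect ((randomSum q)^[n] sig) fun x => f (s + x)
      have hV : f 0 ≤ V := by
        refine le_trans (expect_const (randomSum geo ((randomSum q)^[n] sig)) _).ge
          (expect_mono _ fun s => ?_)
        refine le_trans (expect_const ((randomSum q)^[n] sig) _).ge
          (expect_mono _ fun x => hmono (by omega))
      obtain ⟨e, rfl⟩ := exists_add_of_le hdb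
      have hd1 : d ≠ ∞ := by
        rintro rfl
        simp at hβ
      have hβb : β = b + e := by
        have : d + β = d + (b + e) := by rw [add_comm, hβ, ← hbb]; ring
        exact (ENNReal.add_right_inj hd1).1 this
      rw [hβb, add_mul, add_mul]
      calc b * f 0 + e * f 0 + d * V ≤ b * f 0 + e * V + d * V := by gcongr
        _ = b * f 0 + (d * V + e * V) := by ring
  have h2 : expect (freshLaw q geo sig n) f = stackValue n q geo sig f (1, 0) := by
    rw [stackValue]
    simp [expect_stackLaw_succ, expect_stackLaw_zero]
  have h3 : stackValue n q geo sig f (1, 0) ≤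
      (queueOp n α)^[K] (stackValue n q geo sig f) (1, 0) := by
    refine le_queueOp_iterate ?_ K _ (by simp)
    rintro ⟨c, s⟩ hc
    cases c with
    | zero => rw [queueOp_zero]
    | succ c => exact stackValue_le_queueOp hq hgeo hβ hsig hd hb hb' hmono c s (by simpa using hc)
  -- Once the system is empty the value is f of the actual losses; before that it is at most 1.
  have h4 : (queueOp n α)^[K] (stackValue n q geo sig f) (1, 0) ≤
      (queueOp n α)^[K] ((fun x => f x.2) + busy) (1, 0) := by
    refine queueOp_iterate_le ?_ K _ (by simp)
    rintro ⟨c, s⟩ -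
    cases c with
    | zero => simp [stackValue, expect_stackLaw_zero]
    | succ c =>
      refine le_trans ?_ (le_add_self (a := busy (c + 1, s)))
      rw [busy, if_neg (by simp)]
      exact (expect_mono _ fun t => hf1 _).trans (expect_const _ _).le
  rw [← expect_indicator, expect_galtonWatson]
  rw [queueOp_iterate_add] at h4
  exact h1.trans (h2.le.trans (h3.trans h4))

end Comparison

/-! ### From the operator to sample paths -/

section Path

/-- The customers at the beginning of service `K` and the losses before that. -/
def queueState (n : ℕ) (a : ℕ → ℕ) (K : ℕ) : ℕ × ℕ :=
  (customers n a K, ∑ k ∈ Finset.range K, lostDuring n a k)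

theorem queueState_succ (n : ℕ) (a : ℕ → ℕ) (K : ℕ) :
    queueState n a (K + 1) = queueStep n (queueState n a K) (a K) := by
  rw [queueState, queueStep, Finset.sum_range_succ, customers, lostDuring]
  by_cases h : customers n a K = 0 <;> simp [queueState, h]

theorem queueState_congr (n : ℕ) {a a' : ℕ → ℕ} {K : ℕ} (h : ∀ i < K, a i = a' i) :
    queueState n a K = queueState n a' K := by
  induction K with
  | zero => rfl
  | succ K ih =>
    rw [queueState_succ, queueState_succ, ih fun i hi => h i (by omega), h K (by omega)]

variable {Ω : Type*} [MeasurableSpace Ω] {P : Measure Ω}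

theorem lintegral_comp_countable {ι : Type*} [Countable ι] [MeasurableSpace ι]
    [MeasurableSingletonClass ι] {V : Ω → ι} (hV : Measurable V) (h : ι → ℝ≥0∞) :
    ∫⁻ ω, h (V ω) ∂P = ∑' x, h x * P {ω | V ω = x} := by
  have hm : Measurable h := measurable_of_countable h
  rw [← lintegral_map hm hV, lintegral_countable']
  refine tsum_congr fun x => ?_
  rw [Measure.map_apply hV (measurableSet_singleton x)]
  rfl

/-- The product form of the finite-dimensional laws makes arrival number K independent of the state
before service K, so the last transition can be integrated out as `queueOp`. -/
theorem lintegral_queueState {α : PMF ℕ} [IsProbabilityMeasure P] {a : ℕ → Ω → ℕ}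
    (ha : ∀ k, Measurable (a k))
    (hlaw : ∀ (K : ℕ) (x : ℕ → ℕ), P {ω | ∀ i < K, a i ω = x i} = ∏ i ∈ Finset.range K, α (x i))
    (n K : ℕ) (ψ : ℕ × ℕ → ℝ≥0∞) :
    ∫⁻ ω, ψ (queueState n (fun k => a k ω) K) ∂P = (queueOp n α)^[K] ψ (1, 0) := by
  induction K generalizing ψ with
  | zero => simp [queueState, customers]
  | succ K ih =>
    rw [Function.iterate_succ_apply, ← ih]
    -- The state depends only on the first K arrival numbers, a countably valued vector; padding by
    -- 0 makes it a sequence again.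
    let ext : (Fin K → ℕ) → ℕ → ℕ := fun v i => if h : i < K then v ⟨i, h⟩ else 0
    let V : Ω → (Fin K → ℕ) := fun ω i => a i ω
    have hVm : Measurable V := measurable_pi_lambda _ fun i => ha i
    have hstate : ∀ ω, queueState n (fun k => a k ω) K = queueState n (ext (V ω)) K := by
      intro ω
      refine queueState_congr n fun i hi => ?_
      simp [ext, V, hi]
    have hV : ∀ v, P {ω | V ω = v} = ∏ i ∈ Finset.range K, α (ext v i) := by
      intro v
      rw [← hlaw]
      congr 1
      ext ω
      simp only [Set.mem_ofPred_eq, V, funext_iff, Fin.forall_iff, ext]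
      refine forall₂_congr fun i hi => ?_
      simp [hi]
    have hVa : ∀ v z, P {ω | (V ω, a K ω) = (v, z)} = P {ω | V ω = v} * α z := by
      intro v z
      rw [hV]
      have := hlaw (K + 1) (fun i => if i = K then z else ext v i)
      rw [Finset.prod_range_succ, if_pos rfl] at this
      rw [Finset.prod_congr rfl (g := fun i => α (if i = K then z else ext v i)), ← this]
      · congr 1
        ext ω
        simp only [Set.mem_ofPred_eq, V, Prod.mk.injEq, funext_iff, Fin.forall_iff]
        constructor
        · rintro ⟨h1, h2⟩ i hi
          by_cases hiK : i = K
          · simp [hiK, h2]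
          · have hlt : i < K := by omega
            simp [hiK, ext, h1 i hlt, hlt]
        · intro h
          refine ⟨fun i hi => ?_, ?_⟩
          · rw [h i (by omega), if_neg (by omega)]
            simp [ext, hi]
          · rw [h K (by omega), if_pos rfl]
      · intro i hi
        rw [if_neg (Finset.mem_range.1 hi).ne]
    simp only [queueState_succ, hstate]
    rw [lintegral_comp_countable (V := fun ω => (V ω, a K ω)) (hVm.prodMk (ha K))
      (fun y => ψ (queueStep n (queueState n (ext y.1) K) y.2)),
      lintegral_comp_countable hVm (fun v => queueOp n α ψ (queueState n (ext v) K)),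
      ENNReal.tsum_prod (f := fun v z => ψ (queueStep n (queueState n (ext v) K) z) *
        P {ω | (V ω, a K ω) = (v, z)})]
    refine tsum_congr fun v => ?_
    rw [queueOp, expect, ← ENNReal.tsum_mul_right]
    refine tsum_congr fun z => ?_
    rw [hVa]
    ring

/-- Stochastic lower bound for the losses of a queue with i.i.d. arrival numbers. -/
theorem stochGE_of_iid {α q geo sig : PMF ℕ} [IsProbabilityMeasure P] {a : ℕ → Ω → ℕ}
    (ha : ∀ k, Measurable (a k))
    (hlaw : ∀ (K : ℕ) (x : ℕ → ℕ), P {ω | ∀ i < K, a i ω = x i} = ∏ i ∈ Finset.range K, α (x i))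
    (n : ℕ) {β b d b' : ℝ≥0∞}
    (hq : ∀ f, expect q f = β * f 0 + d * expect geo fun k => f (k + 1))
    (hgeo : ∀ f, expect geo f = b * f 0 + b' * expect geo fun k => f (k + 1))
    (hβ : β + d = 1)
    (hsig : ∀ k m, (∑' r, α (k + r)) * ∑' r, sig (m + r) ≤ ∑' r, α (k + (m + r)))
    (hd : ∀ k, (∑' r, α (k + r)) * d ≤ ∑' r, α (k + 1 + r))
    (hb : b = α 0) (hb' : b' = ∑' r, α (1 + r)) (hpos : α 0 ≠ 0) :
    StochGE P (fun ω => ⨆ K : ℕ,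
      ((∑ k ∈ Finset.range K, lostDuring n (fun k => a k ω) k : ℕ) : ℕ∞))
      (randomSum (galtonWatson q n) sig) := by
  intro m
  set R := P {ω | (m : ℕ∞) ≤ ⨆ K : ℕ,
      ((∑ k ∈ Finset.range K, lostDuring n (fun k => a k ω) k : ℕ) : ℕ∞)}
  -- After (n + 1) j services the losses so far are at most the total, and the probability of still
  -- being busy decays geometrically in j.
  have hbound : ∀ j : ℕ, (randomSum (galtonWatson q n) sig).toMeasure (Set.Ici m) ≤
      R + (1 - α 0 ^ (n + 1)) ^ j := by
    intro j
    refine (toMeasure_Ici_le_queueOp hq hgeo hβ hsig hd hb hb' m ((n + 1) * j)).trans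
      (add_le_add ?_ ?_)
    · rw [← lintegral_queueState ha hlaw]
      refine (lintegral_mono (g := Set.indicator {ω | (m : ℕ∞) ≤ ⨆ K : ℕ,
        ((∑ k ∈ Finset.range K, lostDuring n (fun k => a k ω) k : ℕ) : ℕ∞)} 1)
        fun ω => ?_).trans (lintegral_indicator_one_le _)
      by_cases h : m ≤ (queueState n (fun k => a k ω) ((n + 1) * j)).2
      · rw [Set.indicator_of_mem (show _ ∈ Set.Ici m from h), Set.indicator_of_mem]
        · simp
        · refine le_trans ?_ (le_iSup (fun K : ℕ =>
            ((∑ k ∈ Finset.range K, lostDuring n (fun k => a k ω) k : ℕ) : ℕ∞)) ((n + 1) * j))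
          exact_mod_cast h
      · rw [Set.indicator_of_notMem (show _ ∉ Set.Ici m from h)]
        exact zero_le
    · refine (queueOp_iterate_mul_busy_le j (1, 0) (by simp)).trans ?_
      simp [busy]
  have hlt : 1 - α 0 ^ (n + 1) < 1 :=
    ENNReal.sub_lt_self ENNReal.one_ne_top one_ne_zero (pow_ne_zero _ hpos)
  have hlim := (ENNReal.tendsto_pow_atTop_nhds_zero_of_lt_one hlt).const_add R
  rw [add_zero] at hlim
  exact ge_of_tendsto' hlim hbound

end Path

/-! ### Approximation of times from the right by grid points -/

open Filter Topology

/-- The least point of the grid of mesh `1 / (m + 1)` that exceeds a number with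
`⌊t * (m + 1)⌋ = j`. -/
noncomputable def gridPoint (m j : ℕ) : ℝ≥0 := (j + 1) / (m + 1)

theorem gridPoint_mono (m : ℕ) : Monotone (gridPoint m) := by
  intro i j h
  unfold gridPoint
  gcongr

theorem le_gridPoint (m : ℕ) (t : ℝ≥0) : t ≤ gridPoint m ⌊t * (m + 1)⌋₊ := by
  unfold gridPoint
  rw [le_div_iff₀ (by positivity)]
  exact (Nat.lt_floor_add_one _).le

theorem gridPoint_le (m : ℕ) (t : ℝ≥0) : gridPoint m ⌊t * (m + 1)⌋₊ ≤ t + 1 / (m + 1) := by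
  unfold gridPoint
  rw [add_div]
  gcongr
  rw [div_le_iff₀ (by positivity)]
  exact Nat.floor_le zero_le

theorem tendsto_gridPoint (t : ℝ≥0) :
    Tendsto (fun m : ℕ => gridPoint m ⌊t * (m + 1)⌋₊) atTop (𝓝 t) := by
  have h : Tendsto (fun m : ℕ => t + 1 / ((m : ℝ≥0) + 1)) atTop (𝓝 (t + 0)) :=
    tendsto_const_nhds.add tendsto_one_div_add_atTop_nhds_zero_nat
  rw [add_zero] at h
  exact tendsto_of_tendsto_of_tendsto_of_le_of_le tendsto_const_nhds h
    (fun m => le_gridPoint m t) (fun m => gridPoint_le m t)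

theorem continuous_poissonMeasure_singleton (k : ℕ) :
    Continuous fun r : ℝ≥0 => poissonMeasure r {k} := by
  simp only [poissonMeasure_singleton]
  exact ENNReal.continuous_ofReal.comp (by fun_prop)

/-! ### Arrival numbers during successive services -/

section Arrivals

variable {Ω : Type*} [MeasurableSpace Ω] {P : Measure Ω} {N : ℝ≥0 → Ω → ℕ} {S : ℕ → Ω → ℝ}
  {lam : ℝ} {B : Measure ℝ}

theorem measurable_serviceEpoch (hS : ∀ k, Measurable (S k)) (k : ℕ) :
    Measurable (serviceEpoch S k) := by
  unfold serviceEpoch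
  exact (Finset.measurable_sum _ fun i _ => hS i).real_toNNReal

theorem measurable_comp_countable {ι κ : Type*} [Countable ι] [MeasurableSpace ι]
    [MeasurableSingletonClass ι] [MeasurableSpace κ] {f : ι → Ω → κ} (hf : ∀ j, Measurable (f j))
    {J : Ω → ι} (hJ : Measurable J) : Measurable fun ω => f (J ω) ω :=
  (measurable_from_prod_countable_right (f := fun y : ι × Ω => f y.1 y.2) hf).comp
    (hJ.prodMk measurable_id)

theorem IsPoissonProcess.measurable_gridPoint (h : IsPoissonProcess N lam P) (m : ℕ)
    {J : Ω → ℕ} (hJ : Measurable J) : Measurable fun ω => N (gridPoint m (J ω)) ω :=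
  measurable_comp_countable (f := fun j => N (gridPoint m j)) (fun _ => h.measurable _) hJ

/-- The grid points tend to t from the right; right continuity with values in a discrete space gives
eventual equality, not just convergence. -/
theorem IsPoissonProcess.eventually_gridPoint_eq (h : IsPoissonProcess N lam P) (ω : Ω) (t : ℝ≥0) :
    ∀ᶠ m : ℕ in atTop, N (gridPoint m ⌊t * (m + 1)⌋₊) ω = N t ω := by
  have h1 : Tendsto (fun m : ℕ => gridPoint m ⌊t * (m + 1)⌋₊) atTop (𝓝[Set.Ici t] t) :=
    tendsto_nhdsWithin_iff.2 ⟨tendsto_gridPoint t, Eventually.of_forall fun m => le_gridPoint m t⟩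
  have h2 := (h.rightCts ω t).tendsto.comp h1
  rw [nhds_discrete, tendsto_pure] at h2
  exact h2

/-- Joint law of the increments of a Poisson process over a partition. -/
theorem IsPoissonProcess.prob_increments (h : IsPoissonProcess N lam P) {t : ℕ → ℝ≥0}
    (ht : Monotone t) (K : ℕ) (x : ℕ → ℕ) :
    P {ω | ∀ i < K, N (t (i + 1)) ω - N (t i) ω = x i} =
      ∏ i ∈ Finset.range K, poissonMeasure (lam.toNNReal * (t (i + 1) - t i)) {x i} := by
  have h1 := (h.indepIncrements.nat ht).measure_inter_preimage_eq_mul (Finset.range K)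
    (sets := fun i => {x i}) (fun i _ => measurableSet_singleton _)
  have h2 : {ω | ∀ i < K, N (t (i + 1)) ω - N (t i) ω = x i} =
      ⋂ i ∈ Finset.range K, (fun ω => N (t (i + 1)) ω - N (t i) ω) ⁻¹' {x i} := by
    ext ω
    simp
  rw [h2, h1]
  refine Finset.prod_congr rfl fun i _ => ?_
  exact (h.law (t i) (t (i + 1)) (ht (Nat.le_succ i))).measure_eq
    (p := fun y => y = x i) (measurableSet_singleton _)

/-- The joint law of the increments between discretised service epochs. -/
theorem IsMGIInput.prob_grid_arrivals (h : IsMGIInput N S lam B P)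
    (hpos : ∀ᵐ ω ∂P, ∀ k, 0 ≤ S k ω) (m K : ℕ) (x : ℕ → ℕ) :
    P {ω | ∀ i < K, N (gridPoint m ⌊serviceEpoch S (i + 1) ω * (m + 1)⌋₊) ω -
        N (gridPoint m ⌊serviceEpoch S i ω * (m + 1)⌋₊) ω = x i} =
      ∫⁻ ω, ∏ i ∈ Finset.range K, poissonMeasure (lam.toNNReal *
        (gridPoint m ⌊serviceEpoch S (i + 1) ω * (m + 1)⌋₊ -
          gridPoint m ⌊serviceEpoch S i ω * (m + 1)⌋₊)) {x i} ∂P := by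
  set W : (ℕ → ℝ) → Fin (K + 1) → ℕ :=
    fun s k => ⌊(∑ i ∈ Finset.range k, s i).toNNReal * (m + 1)⌋₊ with hW
  have hWm : Measurable W := by
    refine measurable_pi_lambda _ fun k => Nat.measurable_floor.comp ?_
    refine Measurable.mul_const ?_ _
    exact (Finset.measurable_sum _ fun i _ => measurable_pi_apply i).real_toNNReal
  set V : Ω → Fin (K + 1) → ℕ := fun ω => W fun k => S k ω with hV
  have hVm : Measurable V := hWm.comp (measurable_pi_lambda _ h.service_measurable)
  have hVapp : ∀ ω k (hk : k < K + 1), V ω ⟨k, hk⟩ = ⌊serviceEpoch S k ω * (m + 1)⌋₊ :=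
    fun _ _ _ => rfl
  -- Capping the index at K extends the finite partition to an infinite sequence that is monotone
  -- whenever v is.
  let t : (Fin (K + 1) → ℕ) → ℕ → ℝ≥0 := fun v i => gridPoint m (v ⟨min i K, by omega⟩)
  have htV : ∀ ω i, i ≤ K → t (V ω) i = gridPoint m ⌊serviceEpoch S i ω * (m + 1)⌋₊ := by
    intro ω i hi
    simp only [t, hVapp, min_eq_left hi]
  set A := {ω | ∀ i < K, N (gridPoint m ⌊serviceEpoch S (i + 1) ω * (m + 1)⌋₊) ω -
        N (gridPoint m ⌊serviceEpoch S i ω * (m + 1)⌋₊) ω = x i} with hA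
  have hL : P A = ∑' v, P ({ω | V ω = v} ∩ A) := by
    have h1 := lintegral_comp_countable (P := P.restrict A) hVm (fun _ => 1)
    simp only [lintegral_const, one_mul, Measure.restrict_apply MeasurableSet.univ,
      Set.univ_inter] at h1
    rw [h1]
    exact tsum_congr fun v => Measure.restrict_apply (hVm (measurableSet_singleton v))
  have hR : ∫⁻ ω, ∏ i ∈ Finset.range K, poissonMeasure (lam.toNNReal *
        (gridPoint m ⌊serviceEpoch S (i + 1) ω * (m + 1)⌋₊ -
          gridPoint m ⌊serviceEpoch S i ω * (m + 1)⌋₊)) {x i} ∂P =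
      ∑' v, (∏ i ∈ Finset.range K, poissonMeasure (lam.toNNReal *
        (t v (i + 1) - t v i)) {x i}) * P {ω | V ω = v} := by
    rw [← lintegral_comp_countable hVm]
    refine lintegral_congr fun ω => Finset.prod_congr rfl fun i hi => ?_
    rw [Finset.mem_range] at hi
    rw [htV ω i hi.le, htV ω (i + 1) hi]
  rw [hL, hR]
  refine tsum_congr fun v => ?_
  have hset : {ω | V ω = v} ∩ A =
      {ω | V ω = v} ∩ {ω | ∀ i < K, N (t v (i + 1)) ω - N (t v i) ω = x i} := by
    ext ω
    simp only [Set.mem_inter_iff, Set.mem_ofPred_eq, hA]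
    refine and_congr_right fun hv => forall₂_congr fun i hi => ?_
    rw [← hv, htV ω i hi.le, htV ω (i + 1) hi]
  rw [hset]
  -- For monotone v the grid times are deterministic and increasing, so independence of N and S
  -- applies; other v require a negative service time and have probability zero.
  by_cases hv : Monotone v
  · have hmono : Monotone (t v) := fun i j hij =>
      gridPoint_mono m (hv (Fin.mk_le_mk.2 (min_le_min_right K hij)))
    have hind := h.indep.measure_inter_preimage_eq_mul
      {n : ℝ≥0 → ℕ | ∀ i < K, n (t v (i + 1)) - n (t v i) = x i} (W ⁻¹' {v})
      (by
        simp only [Set.ofPred_forall]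
        refine MeasurableSet.iInter fun i => MeasurableSet.iInter fun _ => ?_
        have h1 : Measurable fun n : ℝ≥0 → ℕ => n (t v (i + 1)) := measurable_pi_apply _
        have h2 : Measurable fun n : ℝ≥0 → ℕ => n (t v i) := measurable_pi_apply _
        exact measurableSet_eq_fun (h1.sub h2) measurable_const)
      (hWm (measurableSet_singleton v))
    rw [Set.inter_comm, ← h.poisson.prob_increments hmono]
    exact hind
  · have hzero : P {ω | V ω = v} = 0 := by
      refine measure_mono_null (t := {ω | ¬ ∀ k, 0 ≤ S k ω}) ?_ hpos
      intro ω hω hS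
      refine hv ?_
      rw [← show V ω = v from hω]
      intro i j hij
      refine Nat.floor_mono (mul_le_mul_left (Real.toNNReal_mono ?_) _)
      exact Finset.sum_le_sum_of_subset_of_nonneg (Finset.range_mono hij) fun k _ _ => hS k
    rw [hzero, mul_zero]
    exact measure_mono_null Set.inter_subset_left hzero

theorem IsMGIInput.measurable_arrivalsDuring (h : IsMGIInput N S lam B P) (k : ℕ) :
    Measurable fun ω => arrivalsDuring N S ω k := by
  have h1 : ∀ k, Measurable fun ω => N (serviceEpoch S k ω) ω := by
    intro k
    refine measurable_of_tendsto_metrizable (f := fun (m : ℕ) ω =>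
      N (gridPoint m ⌊serviceEpoch S k ω * (m + 1)⌋₊) ω) (fun m => ?_) ?_
    · exact h.poisson.measurable_gridPoint m (Nat.measurable_floor.comp
        ((measurable_serviceEpoch h.service_measurable k).mul_const _))
    · rw [tendsto_pi_nhds]
      exact fun ω => tendsto_nhds_of_eventually_eq (h.poisson.eventually_gridPoint_eq ω _)
  exact (h1 (k + 1)).sub (h1 k)

/-- The numbers of arrivals during the successive services are i.i.d. and mixed Poisson. -/
theorem IsMGIInput.prob_arrivals [IsProbabilityMeasure P] (h : IsMGIInput N S lam B P)
    (hB : B (Set.Iio 0) = 0) (K : ℕ) (x : ℕ → ℕ) :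
    P {ω | ∀ i < K, arrivalsDuring N S ω i = x i} =
      ∏ i ∈ Finset.range K, ∫⁻ s, poissonMeasure (lam.toNNReal * s.toNNReal) {x i} ∂B := by
  have hpos : ∀ᵐ ω ∂P, ∀ k, 0 ≤ S k ω := by
    rw [ae_all_iff]
    intro k
    have h1 := (h.service_law k).measure_eq (p := fun y => y < 0) measurableSet_Iio
    rw [show {y : ℝ | y < 0} = Set.Iio 0 from rfl, hB] at h1
    rw [ae_iff]
    simpa only [not_le] using h1
  have hTm := measurable_serviceEpoch h.service_measurable
  have hgm : ∀ m k : ℕ, Measurable fun ω => ⌊serviceEpoch S k ω * ((m : ℝ≥0) + 1)⌋₊ :=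
    fun m k => Nat.measurable_floor.comp ((hTm k).mul_const _)
  have hlimL : Tendsto (fun m : ℕ =>
      P {ω | ∀ i < K, N (gridPoint m ⌊serviceEpoch S (i + 1) ω * (m + 1)⌋₊) ω -
        N (gridPoint m ⌊serviceEpoch S i ω * (m + 1)⌋₊) ω = x i}) atTop
      (𝓝 (P {ω | ∀ i < K, arrivalsDuring N S ω i = x i})) := by
    refine tendsto_measure_of_tendsto_indicator_of_isFiniteMeasure (μ := P) atTop ?_ ?_
    · intro m
      simp only [Set.ofPred_forall]
      refine MeasurableSet.iInter fun i => MeasurableSet.iInter fun _ => ?_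
      exact measurableSet_eq_fun ((h.poisson.measurable_gridPoint m (hgm m (i + 1))).sub
        (h.poisson.measurable_gridPoint m (hgm m i))) measurable_const
    · intro ω
      have h1 : ∀ᶠ m : ℕ in atTop, ∀ k ∈ Finset.range (K + 1),
          N (gridPoint m ⌊serviceEpoch S k ω * (m + 1)⌋₊) ω = N (serviceEpoch S k ω) ω :=
        (Finset.eventually_all _).2 fun k _ => h.poisson.eventually_gridPoint_eq ω _
      filter_upwards [h1] with m hm
      simp only [arrivalsDuring]
      refine forall₂_congr fun i hi => ?_
      rw [hm i (by simp; omega), hm (i + 1) (by simp; omega)]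
  have hlimR : Tendsto (fun m : ℕ => ∫⁻ ω, ∏ i ∈ Finset.range K, poissonMeasure (lam.toNNReal *
        (gridPoint m ⌊serviceEpoch S (i + 1) ω * (m + 1)⌋₊ -
          gridPoint m ⌊serviceEpoch S i ω * (m + 1)⌋₊)) {x i} ∂P) atTop
      (𝓝 (∫⁻ ω, ∏ i ∈ Finset.range K, poissonMeasure (lam.toNNReal *
        (serviceEpoch S (i + 1) ω - serviceEpoch S i ω)) {x i} ∂P)) := by
    refine tendsto_lintegral_of_dominated_convergence (fun _ => 1) ?_ ?_ ?_ ?_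
    · intro m
      refine Finset.measurable_prod _ fun i _ => ?_
      refine (continuous_poissonMeasure_singleton (x i)).measurable.comp
        (Measurable.const_mul (Measurable.sub ?_ ?_) _)
      · exact (measurable_of_countable (gridPoint m)).comp (hgm m (i + 1))
      · exact (measurable_of_countable (gridPoint m)).comp (hgm m i)
    · intro m
      exact Eventually.of_forall fun ω => Finset.prod_le_one' fun i _ => prob_le_one
    · simp
    · refine Eventually.of_forall fun ω => ?_
      refine ENNReal.tendsto_finsetProd_of_ne_top _ (fun i _ => ?_) (fun i _ => measure_ne_top _ _)
      exact ((continuous_poissonMeasure_singleton (x i)).tendsto _).comp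
        (((tendsto_gridPoint _).sub (tendsto_gridPoint _)).const_mul _)
  -- Both sides of the grid identity converge as the mesh tends to zero.
  rw [tendsto_nhds_unique (hlimL.congr fun m => h.prob_grid_arrivals hpos m K x) hlimR]
  have hm : ∀ k, Measurable fun s : ℝ => poissonMeasure (lam.toNNReal * s.toNNReal) {x k} :=
    fun k => (continuous_poissonMeasure_singleton (x k)).measurable.comp
      (measurable_real_toNNReal.const_mul _)
  calc _ = ∫⁻ ω, ∏ i ∈ Finset.range K,
        poissonMeasure (lam.toNNReal * (S i ω).toNNReal) {x i} ∂P := by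
        refine lintegral_congr_ae ?_
        filter_upwards [hpos] with ω hω
        refine Finset.prod_congr rfl fun i _ => ?_
        have h1 : serviceEpoch S (i + 1) ω - serviceEpoch S i ω = (S i ω).toNNReal := by
          unfold serviceEpoch
          rw [Finset.sum_range_succ, Real.toNNReal_add (Finset.sum_nonneg fun k _ => hω k) (hω i),
            add_tsub_cancel_left]
        rw [h1]
    _ = ∏ i ∈ Finset.range K,
        ∫⁻ ω, poissonMeasure (lam.toNNReal * (S i ω).toNNReal) {x i} ∂P := by
        refine lintegral_prod_eq_prod_lintegral_of_indepFun (Finset.range K)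
          (fun i ω => poissonMeasure (lam.toNNReal * (S i ω).toNNReal) {x i}) ?_ ?_
        · exact h.service_indep.comp
            (fun i s => poissonMeasure (lam.toNNReal * s.toNNReal) {x i}) hm
        · exact fun i => (hm i).comp (h.service_measurable i)
    _ = _ := by
        refine Finset.prod_congr rfl fun i _ => ?_
        exact (h.service_law i).lintegral_comp (hm i).aemeasurable

end Arrivals

/-! ### Erlang densities and Poisson tails -/

/-- The probability that a Poisson variable of mean `lam * x` equals `k`. -/
noncomputable def poissonWeight (lam : ℝ) (k : ℕ) (x : ℝ) : ℝ :=
  Real.exp (-(lam * x)) * (lam * x) ^ k / (k.factorial : ℝ)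

/-- The density of the `k + 1`-st point of a Poisson process of rate `lam`. -/
noncomputable def erlang (lam : ℝ) (k : ℕ) (x : ℝ) : ℝ≥0∞ :=
  ENNReal.ofReal (lam * poissonWeight lam k x)

/-- The integral of `R` over the half line against the Erlang density. -/
noncomputable def erlangIntegral (lam : ℝ) (k : ℕ) (R : ℝ → ℝ≥0∞) : ℝ≥0∞ :=
  ∫⁻ x in Set.Ioi 0, erlang lam k x * R x

section Erlang

variable {lam : ℝ}

theorem continuous_poissonWeight (lam : ℝ) (k : ℕ) : Continuous (poissonWeight lam k) := by
  unfold poissonWeight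
  fun_prop

theorem poissonWeight_nonneg (hlam : 0 < lam) (k : ℕ) {x : ℝ} (hx : 0 ≤ x) :
    0 ≤ poissonWeight lam k x := by
  unfold poissonWeight
  positivity

@[fun_prop]
theorem measurable_erlang (lam : ℝ) (k : ℕ) : Measurable (erlang lam k) :=
  ((continuous_poissonWeight lam k).measurable.const_mul lam).ennreal_ofReal

theorem poissonMeasure_eq_ofReal (hlam : 0 < lam) {x : ℝ} (hx : 0 ≤ x) (k : ℕ) :
    poissonMeasure (lam.toNNReal * x.toNNReal) {k} = ENNReal.ofReal (poissonWeight lam k x) := by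
  rw [poissonMeasure_singleton, poissonWeight, NNReal.coe_mul, Real.coe_toNNReal _ hlam.le,
    Real.coe_toNNReal _ hx]

theorem hasSum_poissonWeight (hlam : 0 < lam) {x : ℝ} (hx : 0 ≤ x) :
    HasSum (fun k => poissonWeight lam k x) 1 := by
  have h := hasSum_one_poissonMeasure (lam.toNNReal * x.toNNReal)
  simpa only [NNReal.coe_mul, Real.coe_toNNReal _ hlam.le, Real.coe_toNNReal _ hx, poissonWeight]
    using h

theorem hasDerivAt_poissonWeight_zero (lam x : ℝ) :
    HasDerivAt (poissonWeight lam 0) (-(lam * poissonWeight lam 0 x)) x := by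
  have h : HasDerivAt (fun x => Real.exp (-(lam * x))) (Real.exp (-(lam * x)) * -(lam * 1)) x :=
    (((hasDerivAt_id x).const_mul lam).neg).exp
  have h2 : poissonWeight lam 0 = fun x => Real.exp (-(lam * x)) := by
    funext x
    simp [poissonWeight]
  rw [h2]
  convert h using 1
  ring

theorem hasDerivAt_poissonWeight_succ (lam : ℝ) (k : ℕ) (x : ℝ) :
    HasDerivAt (poissonWeight lam (k + 1))
      (lam * poissonWeight lam k x - lam * poissonWeight lam (k + 1) x) x := by
  have h1 : HasDerivAt (fun x => Real.exp (-(lam * x))) (Real.exp (-(lam * x)) * -(lam * 1)) x :=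
    (((hasDerivAt_id x).const_mul lam).neg).exp
  have h2 : HasDerivAt (fun x => (lam * x) ^ (k + 1)) (((k + 1 : ℕ) : ℝ) * (lam * x) ^ k * (lam * 1))
      x := by
    simpa using ((hasDerivAt_id x).const_mul lam).fun_pow (k + 1)
  have h3 := (h1.mul h2).div_const ((k + 1).factorial : ℝ)
  refine (h3.congr_deriv ?_)
  have hk : ((k.factorial : ℕ) : ℝ) ≠ 0 := by positivity
  have hk1 : ((k : ℝ) + 1) ≠ 0 := by positivity
  unfold poissonWeight
  rw [Nat.factorial_succ]
  push_cast
  field_simp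
  ring

/-- The derivatives of consecutive Poisson weights telescope. -/
theorem hasDerivAt_sum_poissonWeight (lam : ℝ) (k : ℕ) (x : ℝ) :
    HasDerivAt (fun x => ∑ i ∈ Finset.range (k + 1), poissonWeight lam i x)
      (-(lam * poissonWeight lam k x)) x := by
  induction k with
  | zero => simpa using hasDerivAt_poissonWeight_zero lam x
  | succ k ih =>
    simp only [Finset.sum_range_succ _ (k + 1)]
    refine (ih.add (hasDerivAt_poissonWeight_succ lam k x)).congr_deriv ?_
    ring

theorem setLIntegral_Ioo_ofReal {f : ℝ → ℝ} (hf : Continuous f) {x : ℝ} (hx : 0 ≤ x)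
    (hf0 : ∀ u, 0 ≤ u → u ≤ x → 0 ≤ f u) :
    ∫⁻ u in Set.Ioo 0 x, ENNReal.ofReal (f u) = ENNReal.ofReal (∫ u in (0 : ℝ)..x, f u) := by
  rw [intervalIntegral.integral_of_le hx, ofReal_integral_eq_lintegral_ofReal]
  · exact setLIntegral_congr Ioo_ae_eq_Ioc
  · exact (hf.integrableOn_Icc).mono_set Set.Ioc_subset_Icc_self
  · refine (ae_restrict_iff' measurableSet_Ioc).2 (Filter.Eventually.of_forall fun u hu => ?_)
    exact hf0 u hu.1.le hu.2

theorem integral_mul_poissonWeight (lam : ℝ) (k : ℕ) (x : ℝ) :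
    ∫ u in (0 : ℝ)..x, lam * poissonWeight lam k u =
      1 - ∑ i ∈ Finset.range (k + 1), poissonWeight lam i x := by
  have h := intervalIntegral.integral_eq_sub_of_hasDerivAt
    (f := fun x => -∑ i ∈ Finset.range (k + 1), poissonWeight lam i x)
    (f' := fun u => lam * poissonWeight lam k u) (a := 0) (b := x)
    (fun u _ => by simpa using (hasDerivAt_sum_poissonWeight lam k u).fun_neg)
    ((continuous_const.mul (continuous_poissonWeight lam k)).intervalIntegrable _ _)
  have h0 : ∑ i ∈ Finset.range k, poissonWeight lam (i + 1) 0 = 0 :=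
    Finset.sum_eq_zero fun i _ => by simp [poissonWeight]
  have h1 : ∑ i ∈ Finset.range (k + 1), poissonWeight lam i 0 = 1 := by
    rw [Finset.sum_range_succ', h0]
    simp [poissonWeight]
  rw [h, h1]
  ring

theorem setLIntegral_erlang (hlam : 0 < lam) (k : ℕ) {x : ℝ} (hx : 0 ≤ x) :
    ∫⁻ u in Set.Ioo 0 x, erlang lam k u =
      ∑' r, poissonMeasure (lam.toNNReal * x.toNNReal) {k + 1 + r} := by
  unfold erlang
  rw [setLIntegral_Ioo_ofReal (f := fun u => lam * poissonWeight lam k u)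
    (continuous_const.mul (continuous_poissonWeight lam k)) hx
    fun u hu _ => mul_nonneg hlam.le (poissonWeight_nonneg hlam k hu), integral_mul_poissonWeight]
  simp only [poissonMeasure_eq_ofReal hlam hx]
  have hs := (hasSum_nat_add_iff' (k + 1)).2 (hasSum_poissonWeight hlam hx)
  rw [← hs.tsum_eq, ENNReal.ofReal_tsum_of_nonneg
    (fun n => poissonWeight_nonneg hlam _ hx) hs.summable]
  simp only [add_comm _ (k + 1)]

/-- At least k + 1 points fall in a random time exactly when point number k + 1 comes before it;
Tonelli then exchanges the point with the random time. -/
theorem lintegral_poisson_tail (hlam : 0 < lam) (G : Measure ℝ) [IsProbabilityMeasure G]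
    (hG : G (Set.Iio 0) = 0) (k : ℕ) :
    ∑' r, ∫⁻ s, poissonMeasure (lam.toNNReal * s.toNNReal) {k + 1 + r} ∂G =
      erlangIntegral lam k fun u => G (Set.Ioi u) := by
  have hpos : ∀ᵐ s ∂G, 0 ≤ s := by
    rw [ae_iff]
    simp only [not_le]
    exact hG
  have hm : ∀ r, Measurable fun s : ℝ => poissonMeasure (lam.toNNReal * s.toNNReal) {k + 1 + r} :=
    fun r => (continuous_poissonMeasure_singleton _).measurable.comp
      (measurable_real_toNNReal.const_mul _)
  rw [← lintegral_tsum fun r => (hm r).aemeasurable]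
  have hset : MeasurableSet {y : ℝ × ℝ | y.2 < y.1} := measurableSet_lt measurable_snd measurable_fst
  have h1 : ∀ᵐ s ∂G, ∑' r, poissonMeasure (lam.toNNReal * s.toNNReal) {k + 1 + r} =
      ∫⁻ u in Set.Ioi 0, {y : ℝ × ℝ | y.2 < y.1}.indicator (fun y => erlang lam k y.2) (s, u) := by
    filter_upwards [hpos] with s hs
    rw [← setLIntegral_erlang hlam k hs, ← lintegral_indicator measurableSet_Ioo,
      ← lintegral_indicator measurableSet_Ioi]
    refine lintegral_congr fun u => ?_
    by_cases h0 : 0 < u <;> by_cases hu : u < s <;> simp [h0, hu]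
  rw [lintegral_congr_ae h1, lintegral_lintegral_swap]
  · refine lintegral_congr fun u => ?_
    have h2 : ∀ s, {y : ℝ × ℝ | y.2 < y.1}.indicator (fun y => erlang lam k y.2) (s, u) =
        (Set.Ioi u).indicator (fun _ => erlang lam k u) s := by
      intro s
      by_cases hu : u < s <;> simp [hu]
    simp only [h2]
    rw [lintegral_indicator_const measurableSet_Ioi]
  · exact (((measurable_erlang lam k).comp measurable_snd).indicator hset).aemeasurable

theorem erlangIntegral_one (hlam : 0 < lam) (k : ℕ) : erlangIntegral lam k (fun _ => 1) = 1 := by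
  have h := lintegral_gammaPDF_eq_one (a := (k : ℝ) + 1) (r := lam) (by positivity) hlam
  rw [← lintegral_add_compl _ measurableSet_Ioi (A := Set.Ioi (0 : ℝ)), Set.compl_Ioi,
    setLIntegral_congr Iio_ae_eq_Iic.symm, lintegral_gammaPDF_of_nonpos le_rfl, add_zero] at h
  refine Eq.trans ?_ h
  refine setLIntegral_congr_fun measurableSet_Ioi fun x hx => ?_
  have hx0 : (0 : ℝ) ≤ x := le_of_lt hx
  rw [mul_one, gammaPDF_of_nonneg hx0, erlang, poissonWeight, Real.Gamma_nat_eq_factorial,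
    add_sub_cancel_right, Real.rpow_natCast, ← Nat.cast_succ, Real.rpow_natCast,
    Nat.succ_eq_add_one]
  congr 1
  ring

theorem erlangIntegral_mono (k : ℕ) {R R' : ℝ → ℝ≥0∞} (h : ∀ x, 0 < x → R x ≤ R' x) :
    erlangIntegral lam k R ≤ erlangIntegral lam k R' :=
  setLIntegral_mono' measurableSet_Ioi fun x hx => mul_le_mul_right (h x hx) _

theorem erlangIntegral_congr (k : ℕ) {R R' : ℝ → ℝ≥0∞} (h : ∀ x, 0 < x → R x = R' x) :
    erlangIntegral lam k R = erlangIntegral lam k R' :=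
  le_antisymm (erlangIntegral_mono k fun x hx => (h x hx).le)
    (erlangIntegral_mono k fun x hx => (h x hx).ge)

theorem erlangIntegral_add (k : ℕ) {R R' : ℝ → ℝ≥0∞} (hR : Measurable R) :
    erlangIntegral lam k (fun x => R x + R' x) = erlangIntegral lam k R + erlangIntegral lam k R' := by
  unfold erlangIntegral
  simp only [mul_add]
  exact lintegral_add_left ((measurable_erlang lam k).mul hR) _

theorem erlangIntegral_const_mul (k : ℕ) (c : ℝ≥0∞) {R : ℝ → ℝ≥0∞} (hR : Measurable R) :
    erlangIntegral lam k (fun x => c * R x) = c * erlangIntegral lam k R := by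
  unfold erlangIntegral
  rw [← lintegral_const_mul (f := fun x => erlang lam k x * R x) _
    ((measurable_erlang lam k).mul hR)]
  simp only [mul_left_comm]

theorem erlangIntegral_const (hlam : 0 < lam) (k : ℕ) (c : ℝ≥0∞) :
    erlangIntegral lam k (fun _ => c) = c := by
  have h := erlangIntegral_const_mul (lam := lam) k c (measurable_const (a := (1 : ℝ≥0∞)))
  simpa only [erlangIntegral_one hlam, mul_one] using h

theorem erlangIntegral_le_one (hlam : 0 < lam) (k : ℕ) {R : ℝ → ℝ≥0∞} (hR : ∀ x, 0 < x → R x ≤ 1) :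
    erlangIntegral lam k R ≤ 1 :=
  (erlangIntegral_mono k hR).trans (erlangIntegral_one hlam k).le

/-- The Beta integral, by induction on k through integration by parts. -/
theorem integral_pow_mul_sub_pow (k : ℕ) : ∀ (m : ℕ) (u : ℝ),
    ∫ y in (0 : ℝ)..u, y ^ k * (u - y) ^ m =
      (k.factorial : ℝ) * m.factorial / ((k + m + 1).factorial : ℝ) * u ^ (k + m + 1) := by
  induction k with
  | zero =>
    intro m u
    have h := intervalIntegral.integral_comp_sub_left (a := 0) (b := u) (fun y : ℝ => y ^ m) u
    simp only [pow_zero, one_mul, zero_add, Nat.factorial_zero, Nat.cast_one]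
    rw [h, integral_pow, Nat.factorial_succ]
    push_cast
    field_simp
    simp
  | succ k ih =>
    intro m u
    have hd : ∀ y : ℝ, HasDerivAt (fun y : ℝ => y ^ (k + 1) * (u - y) ^ (m + 1))
        (((k : ℝ) + 1) * (y ^ k * (u - y) ^ (m + 1)) - ((m : ℝ) + 1) * (y ^ (k + 1) * (u - y) ^ m))
        y := by
      intro y
      have h1 : HasDerivAt (fun y : ℝ => y ^ (k + 1)) (((k + 1 : ℕ) : ℝ) * y ^ k) y := by
        simpa using hasDerivAt_pow (k + 1) y
      have h2 : HasDerivAt (fun y : ℝ => (u - y) ^ (m + 1))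
          (((m + 1 : ℕ) : ℝ) * (u - y) ^ m * (-1)) y := by
        simpa using ((hasDerivAt_id y).const_sub u).fun_pow (m + 1)
      refine (h1.mul h2).congr_deriv ?_
      push_cast
      ring
    have h := intervalIntegral.integral_eq_sub_of_hasDerivAt (a := 0) (b := u) (fun y _ => hd y)
      (Continuous.intervalIntegrable (by fun_prop) _ _)
    rw [intervalIntegral.integral_sub (Continuous.intervalIntegrable (by fun_prop) _ _)
      (Continuous.intervalIntegrable (by fun_prop) _ _), intervalIntegral.integral_const_mul,
      intervalIntegral.integral_const_mul, ih (m + 1) u] at h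
    simp only [sub_self, ne_eq, Nat.add_eq_zero_iff, one_ne_zero, and_false, not_false_eq_true,
      zero_pow, mul_zero, zero_mul, sub_zero] at h
    have hm : ((m : ℝ) + 1) ≠ 0 := by positivity
    have h3 : ∫ y in (0 : ℝ)..u, y ^ (k + 1) * (u - y) ^ m = (((k : ℝ) + 1) *
        ((k.factorial : ℝ) * (m + 1).factorial / ((k + (m + 1) + 1).factorial : ℝ) *
          u ^ (k + (m + 1) + 1))) / ((m : ℝ) + 1) := by
      rw [eq_div_iff hm]
      linarith
    rw [h3, show k + (m + 1) + 1 = k + 1 + m + 1 by omega, Nat.factorial_succ m,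
      Nat.factorial_succ k]
    push_cast
    field_simp

theorem setLIntegral_erlang_conv (hlam : 0 < lam) (k m : ℕ) {u : ℝ} (hu : 0 ≤ u) :
    ∫⁻ y in Set.Ioo 0 u, erlang lam k y * erlang lam m (u - y) = erlang lam (k + m + 1) u := by
  have h1 : ∫⁻ y in Set.Ioo 0 u, erlang lam k y * erlang lam m (u - y) =
      ∫⁻ y in Set.Ioo 0 u, ENNReal.ofReal (lam ^ (k + m + 2) * Real.exp (-(lam * u)) /
        (k.factorial * m.factorial) * (y ^ k * (u - y) ^ m)) := by
    refine setLIntegral_congr_fun measurableSet_Ioo fun y hy => ?_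
    have hy0 : 0 ≤ lam * poissonWeight lam k y :=
      mul_nonneg hlam.le (poissonWeight_nonneg hlam k hy.1.le)
    simp only [erlang]
    rw [← ENNReal.ofReal_mul hy0]
    congr 1
    have he : Real.exp (-(lam * u)) = Real.exp (-(lam * y)) * Real.exp (-(lam * (u - y))) := by
      rw [← Real.exp_add]
      ring_nf
    rw [he, poissonWeight, poissonWeight, mul_pow, mul_pow]
    field_simp
    ring
  rw [h1, setLIntegral_Ioo_ofReal (by fun_prop) hu fun y hy hyu => by
    have : 0 ≤ u - y := by linarith
    positivity, intervalIntegral.integral_const_mul, integral_pow_mul_sub_pow, erlang,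
    poissonWeight, mul_pow]
  congr 1
  field_simp
  ring

/-- Point k + m + 2 is point m + 1 of the process restarted at point k + 1. This lets a tail of α be
conditioned on the age of the service at its arrival number k + 1. -/
theorem erlangIntegral_conv (hlam : 0 < lam) (k m : ℕ) {R : ℝ → ℝ≥0∞} (hR : Measurable R) :
    erlangIntegral lam k (fun y => erlangIntegral lam m fun x => R (x + y)) =
      erlangIntegral lam (k + m + 1) R := by
  have h1 : ∀ y : ℝ, 0 < y → (erlangIntegral lam m fun x => R (x + y)) =
      ∫⁻ u in Set.Ioi 0, (Set.Ioi y).indicator (fun u => erlang lam m (u - y) * R u) u := by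
    intro y hy
    rw [erlangIntegral, ← lintegral_indicator measurableSet_Ioi,
      ← lintegral_indicator measurableSet_Ioi,
      ← lintegral_sub_right_eq_self _ y]
    refine lintegral_congr fun u => ?_
    by_cases huy : y < u
    · simp [huy, hy.trans huy]
    · simp [huy, Set.indicator_apply]
  rw [erlangIntegral_congr k h1]
  unfold erlangIntegral
  have hset : MeasurableSet {z : ℝ × ℝ | z.1 < z.2} := measurableSet_lt measurable_fst measurable_snd
  have hmeas : Measurable fun z : ℝ × ℝ => erlang lam k z.1 *
      {z : ℝ × ℝ | z.1 < z.2}.indicator (fun z => erlang lam m (z.2 - z.1) * R z.2) z := by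
    refine Measurable.mul (by fun_prop) (Measurable.indicator ?_ hset)
    exact ((measurable_erlang lam m).comp (measurable_snd.sub measurable_fst)).mul
      (hR.comp measurable_snd)
  have h2 : ∀ y, erlang lam k y *
      ∫⁻ u in Set.Ioi 0, (Set.Ioi y).indicator (fun u => erlang lam m (u - y) * R u) u =
      ∫⁻ u in Set.Ioi 0, erlang lam k y *
        {z : ℝ × ℝ | z.1 < z.2}.indicator (fun z => erlang lam m (z.2 - z.1) * R z.2) (y, u) := by
    intro y
    rw [← lintegral_const_mul]
    · refine lintegral_congr fun u => ?_
      by_cases huy : y < u <;> simp [huy]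
    · refine Measurable.indicator ?_ measurableSet_Ioi
      exact ((measurable_erlang lam m).comp (measurable_id.sub_const y)).mul hR
  simp only [h2]
  rw [lintegral_lintegral_swap hmeas.aemeasurable]
  refine setLIntegral_congr_fun measurableSet_Ioi fun u hu => ?_
  have hu0 : (0 : ℝ) < u := hu
  rw [← setLIntegral_erlang_conv hlam k m hu0.le, ← lintegral_mul_const _ (by fun_prop),
    ← lintegral_indicator measurableSet_Ioi, ← lintegral_indicator measurableSet_Ioo]
  refine lintegral_congr fun y => ?_
  by_cases hy : 0 < y <;> by_cases huy : y < u <;> simp [hy, huy, mul_assoc]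

theorem integrableOn_mul_poissonWeight (hlam : 0 < lam) (k : ℕ) :
    IntegrableOn (fun x => lam * poissonWeight lam k x) (Set.Ioi 0) := by
  refine (lintegral_ofReal_ne_top_iff_integrable ?_ ?_).1 ?_
  · exact (continuous_const.mul (continuous_poissonWeight lam k)).aestronglyMeasurable
  · refine (ae_restrict_iff' measurableSet_Ioi).2 (Filter.Eventually.of_forall fun u hu => ?_)
    exact mul_nonneg hlam.le (poissonWeight_nonneg hlam k (le_of_lt hu))
  · have h := erlangIntegral_one hlam k
    simp only [erlangIntegral, mul_one, erlang] at h
    rw [h]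
    exact ENNReal.one_ne_top

/-- Up to the positive factor λ^(k+1) / k!, the integral in `LeC` with exponent k is the integral
against the Erlang density; passing to tails reverses the inequality. -/
theorem erlangIntegral_le_of_leC (hlam : 0 < lam) {X Y : ℝ → ℝ} (hX : Measurable X)
    (hY : Measurable Y) (hX0 : ∀ x, 0 < x → X x ∈ Set.Icc (0 : ℝ) 1)
    (hY0 : ∀ x, 0 < x → Y x ∈ Set.Icc (0 : ℝ) 1)
    (h : LeC lam X Y) (k : ℕ) :
    erlangIntegral lam k (fun x => ENNReal.ofReal (1 - X x)) ≤
      erlangIntegral lam k fun x => ENNReal.ofReal (1 - Y x) := by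
  have hw := integrableOn_mul_poissonWeight hlam k
  have hint : ∀ Z : ℝ → ℝ, Measurable Z → (∀ x, 0 < x → Z x ∈ Set.Icc (0 : ℝ) 1) →
      IntegrableOn (fun x => lam * poissonWeight lam k x * Z x) (Set.Ioi 0) := by
    intro Z hZ hZ0
    refine Integrable.mono' hw (hw.aestronglyMeasurable.mul hZ.aestronglyMeasurable) ?_
    refine (ae_restrict_iff' measurableSet_Ioi).2 (Filter.Eventually.of_forall fun u hu => ?_)
    have h1 := mul_nonneg hlam.le (poissonWeight_nonneg hlam k (le_of_lt hu))
    rw [norm_mul, Real.norm_of_nonneg h1, Real.norm_of_nonneg (hZ0 u hu).1]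
    exact mul_le_of_le_one_right h1 (hZ0 u hu).2
  have hval : ∀ Z : ℝ → ℝ, Measurable Z → (∀ x, 0 < x → Z x ∈ Set.Icc (0 : ℝ) 1) →
      erlangIntegral lam k (fun x => ENNReal.ofReal (1 - Z x)) =
        ENNReal.ofReal ((∫ x in Set.Ioi 0, lam * poissonWeight lam k x) -
          lam ^ (k + 1) / (k.factorial : ℝ) *
            ∫ x in Set.Ioi (0 : ℝ), Real.exp (-(lam * x)) * x ^ k * Z x) := by
    intro Z hZ hZ0
    have h2 : lam ^ (k + 1) / (k.factorial : ℝ) *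
            ∫ x in Set.Ioi (0 : ℝ), Real.exp (-(lam * x)) * x ^ k * Z x =
        ∫ x in Set.Ioi (0 : ℝ), lam * poissonWeight lam k x * Z x := by
      rw [← integral_const_mul]
      congr 1
      funext x
      unfold poissonWeight
      rw [mul_pow]
      ring
    rw [h2, ← integral_sub hw (hint Z hZ hZ0), ofReal_integral_eq_lintegral_ofReal]
    · refine setLIntegral_congr_fun measurableSet_Ioi fun x hx => ?_
      have h1 := mul_nonneg hlam.le (poissonWeight_nonneg hlam k (le_of_lt hx))
      simp only [erlang]
      rw [← ENNReal.ofReal_mul h1]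
      congr 1
      ring
    · exact hw.sub (hint Z hZ hZ0)
    · refine (ae_restrict_iff' measurableSet_Ioi).2 (Filter.Eventually.of_forall fun x hx => ?_)
      have h1 := mul_nonneg hlam.le (poissonWeight_nonneg hlam k (le_of_lt hx))
      have h3 := mul_le_of_le_one_right h1 (hZ0 x hx).2
      simp only [Pi.zero_apply]
      linarith
  rw [hval X hX hX0, hval Y hY hY0]
  refine ENNReal.ofReal_le_ofReal (sub_le_sub_left ?_ _)
  exact mul_le_mul_of_nonneg_left (h k) (by positivity)

/-- The integrand is λ / (λ + μ) times the exponential density of rate λ + μ. -/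
theorem erlangIntegral_zero_exp (hlam : 0 < lam) {mu : ℝ} (hmu : 0 < mu) :
    erlangIntegral lam 0 (fun x => ENNReal.ofReal (Real.exp (-(mu * x)))) =
      ENNReal.ofReal (lam / (lam + mu)) := by
  have h := erlangIntegral_one (lam := lam + mu) (by positivity) 0
  have h2 := erlangIntegral_const_mul (lam := lam + mu) 0 (ENNReal.ofReal (lam / (lam + mu)))
    (measurable_const (a := (1 : ℝ≥0∞)))
  rw [h, mul_one] at h2
  rw [← h2]
  refine setLIntegral_congr_fun measurableSet_Ioi fun x hx => ?_
  simp only [erlang, poissonWeight]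
  rw [← ENNReal.ofReal_mul (by positivity), ← ENNReal.ofReal_mul (by positivity)]
  congr 1
  have he : Real.exp (-((lam + mu) * x)) = Real.exp (-(lam * x)) * Real.exp (-(mu * x)) := by
    rw [← Real.exp_add]
    ring_nf
  rw [he]
  field_simp

end Erlang

/-! ### Residual laws -/

section Residual

theorem cdf_mem_Icc (F : Measure ℝ) (x : ℝ) :
    cdf F x ∈ Set.Icc (0 : ℝ) 1 := ⟨cdf_nonneg F x, cdf_le_one F x⟩

theorem antitone_one_sub_cdf (F : Measure ℝ) : Antitone fun x => 1 - cdf F x :=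
  fun _ _ h => sub_le_sub_left (monotone_cdf F h) 1

theorem measure_Ioi_eq_zero_of_not_reachable {F : Measure ℝ} {y : ℝ} (hy : 0 ≤ y) (h : ¬ Reachable F y) :
    F (Set.Ioi y) = 0 := by
  by_contra h1
  exact h ⟨hy, h1⟩

variable (F : Measure ℝ) [IsProbabilityMeasure F]

theorem measureReal_Ioi (x : ℝ) : F.real (Set.Ioi x) = 1 - cdf F x := by
  rw [cdf_eq_real, ← Set.compl_Iic, probReal_compl_eq_one_sub measurableSet_Iic]

theorem measure_Ioi (x : ℝ) : F (Set.Ioi x) = ENNReal.ofReal (1 - cdf F x) := by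
  rw [← measureReal_Ioi, ofReal_measureReal]

variable {F}

theorem one_sub_cdf_add {y : ℝ} (hy : Reachable F y) {x : ℝ} (hx : 0 ≤ x) :
    1 - cdf F (x + y) = (1 - cdf F y) * (1 - residual F y x) := by
  have h0 : 1 - cdf F y ≠ 0 := by
    intro h
    apply hy.2
    rw [measure_Ioi, h, ENNReal.ofReal_zero]
  have h1 : residual F y x = (1 - cdf F y)⁻¹ * (cdf F (x + y) - cdf F y) := by
    rw [residual, measureReal_def, cond_apply measurableSet_Ioi, ENNReal.toReal_mul,
      ENNReal.toReal_inv, ← measureReal_def, ← measureReal_def, measureReal_Ioi,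
      Set.Ioi_inter_Iic]
    congr 1
    rw [cdf_eq_real, cdf_eq_real, ← Set.Iic_sdiff_Iic,
      measureReal_sdiff (Set.Iic_subset_Iic.2 (by linarith)) measurableSet_Iic]
  rw [h1]
  field_simp
  ring

theorem monotone_residual (F : Measure ℝ) [IsProbabilityMeasure F] (y : ℝ) :
    Monotone (residual F y) :=
  fun _ _ h => measureReal_mono (Set.Iic_subset_Iic.2 (by linarith))

theorem residual_mem_Icc (F : Measure ℝ) [IsProbabilityMeasure F] (y x : ℝ) :
    residual F y x ∈ Set.Icc (0 : ℝ) 1 := by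
  refine ⟨measureReal_nonneg, ?_⟩
  refine ENNReal.toReal_le_of_le_ofReal zero_le_one ?_
  rw [ENNReal.ofReal_one]
  exact prob_le_one

theorem expCdf_mem_Icc {mu : ℝ} (hmu : 0 < mu) {x : ℝ} (hx : 0 ≤ x) :
    expCdf mu x ∈ Set.Icc (0 : ℝ) 1 := by
  have h1 : Real.exp (-(mu * x)) ≤ 1 := Real.exp_le_one_iff.2 (by nlinarith)
  have h2 := Real.exp_pos (-(mu * x))
  unfold expCdf
  constructor <;> linarith

theorem one_sub_expCdf (mu x : ℝ) : 1 - expCdf mu x = Real.exp (-(mu * x)) := by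
  unfold expCdf
  ring

theorem measurable_expCdf (mu : ℝ) : Measurable (expCdf mu) := by
  unfold expCdf
  fun_prop

/-- Multiplying by the tail at y removes the conditioning. At an unreachable age both tails vanish,
so the bound needs no restriction on y. -/
theorem abs_mul_sub_le_of_residual {δ : ℝ}
    (hδ : ∀ x y : ℝ, 0 ≤ x → Reachable F y → |residual F y x - cdf F x| ≤ δ)
    {x y : ℝ} (hx : 0 ≤ x) (hy : 0 ≤ y) :
    |(1 - cdf F x) * (1 - cdf F y) - (1 - cdf F (x + y))| ≤ δ * (1 - cdf F y) := by
  have hy0 : 0 ≤ 1 - cdf F y := sub_nonneg.2 (cdf_le_one F y)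
  by_cases h : Reachable F y
  · rw [one_sub_cdf_add h hx,
      show (1 - cdf F x) * (1 - cdf F y) - (1 - cdf F y) * (1 - residual F y x) =
        (residual F y x - cdf F x) * (1 - cdf F y) by ring, abs_mul, abs_of_nonneg hy0]
    exact mul_le_mul_of_nonneg_right (hδ x y hx h) hy0
  · have h1 := measure_Ioi_eq_zero_of_not_reachable hy h
    have h2 : 1 - cdf F y = 0 := by
      rw [← measureReal_Ioi, measureReal_def, h1, ENNReal.toReal_zero]
    have h3 : 1 - cdf F (x + y) = 0 := by
      refine le_antisymm ?_ (sub_nonneg.2 (cdf_le_one F _))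
      rw [← h2]
      exact antitone_one_sub_cdf F (by linarith)
    rw [h2, h3]
    simp

end Residual

/-! ### Closeness to the exponential law -/

section Equilibrium

/-- A Grönwall argument: H' = -μ R ≤ -μ (H - c), compared with the solution of the linear equation
after multiplication by e^{μx}. -/
theorem le_exp_add_of_rightDeriv {R H : ℝ → ℝ} {mu c : ℝ} (hmu : 0 < mu)
    (hcont : Continuous H) (hH0 : H 0 = 1)
    (hderiv : ∀ x, 0 ≤ x → HasDerivWithinAt H (-(mu * R x)) (Set.Ici x) x)
    (hle : ∀ x, 0 ≤ x → H x - c ≤ R x) {x : ℝ} (hx : 0 ≤ x) :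
    H x ≤ Real.exp (-(mu * x)) + c * (1 - Real.exp (-(mu * x))) := by
  have hexp : ∀ y : ℝ, HasDerivAt (fun y => Real.exp (mu * y)) (mu * Real.exp (mu * y)) y := by
    intro y
    have := ((hasDerivAt_id y).const_mul mu).exp
    simpa [mul_comm] using this
  have key := image_le_of_deriv_right_le_deriv_boundary (a := 0) (b := x)
    (f := fun y => H y * Real.exp (mu * y)) (B := fun y => 1 + c * (Real.exp (mu * y) - 1))
    (f' := fun y => -(mu * R y) * Real.exp (mu * y) + H y * (mu * Real.exp (mu * y)))
    (B' := fun y => c * (mu * Real.exp (mu * y)))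
    (hcont.mul (by fun_prop)).continuousOn
    (fun y hy => (hderiv y hy.1).mul (hexp y).hasDerivWithinAt)
    (by simp [hH0])
    (Continuous.continuousOn (by fun_prop))
    (fun y _ => ((((hexp y).sub_const 1).const_mul c).const_add 1).hasDerivWithinAt)
    (fun y hy => by
      have h1 := hle y hy.1
      have h2 : 0 < mu * Real.exp (mu * y) := by positivity
      nlinarith)
    (Set.right_mem_Icc.2 hx)
  have h3 : Real.exp (-(mu * x)) * Real.exp (mu * x) = 1 := by
    rw [← Real.exp_add]
    simp
  have h4 := Real.exp_pos (-(mu * x))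
  calc H x = Real.exp (-(mu * x)) * (H x * Real.exp (mu * x)) := by
        rw [mul_left_comm, h3, mul_one]
    _ ≤ Real.exp (-(mu * x)) * (1 + c * (Real.exp (mu * x) - 1)) :=
        mul_le_mul_of_nonneg_left key h4.le
    _ = _ := by linear_combination c * h3

/-- Reflecting R and H about e^{-μx} preserves the equation and turns the upper estimate into a
lower one. -/
theorem exp_sub_le_of_rightDeriv {R H : ℝ → ℝ} {mu c : ℝ} (hmu : 0 < mu)
    (hcont : Continuous H) (hH0 : H 0 = 1)
    (hderiv : ∀ x, 0 ≤ x → HasDerivWithinAt H (-(mu * R x)) (Set.Ici x) x)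
    (hle : ∀ x, 0 ≤ x → R x ≤ H x + c) {x : ℝ} (hx : 0 ≤ x) :
    Real.exp (-(mu * x)) - c * (1 - Real.exp (-(mu * x))) ≤ H x := by
  have hexp : ∀ y : ℝ, HasDerivAt (fun y => Real.exp (-(mu * y))) (-(mu * Real.exp (-(mu * y)))) y := by
    intro y
    have := ((hasDerivAt_id y).const_mul mu).fun_neg.exp
    simpa [mul_comm] using this
  have h := le_exp_add_of_rightDeriv (R := fun x => 2 * Real.exp (-(mu * x)) - R x)
    (H := fun x => 2 * Real.exp (-(mu * x)) - H x) (c := c) hmu (by fun_prop)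
    (by simp [hH0]; norm_num)
    (fun y hy => ((((hexp y).const_mul 2).hasDerivWithinAt).sub (hderiv y hy)).congr_deriv
      (by ring))
    (fun y hy => by have := hle y hy; linarith) hx
  linarith

variable {F : Measure ℝ} [IsProbabilityMeasure F] {mu δ : ℝ}

/-- A new-better-than-used or new-worse-than-used law whose residual laws are close to it is close
to the exponential law with the same mean. -/
theorem abs_cdf_sub_expCdf_le (hmu : 0 < mu) (hF : F (Set.Iio 0) = 0)
    (hint : Integrable (fun x : ℝ => x) F) (hmean : ∫ x, x ∂F = 1 / mu)
    (hδ0 : 0 ≤ δ) (hδ : ∀ x y : ℝ, 0 ≤ x → Reachable F y → |residual F y x - cdf F x| ≤ δ)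
    (h : NBU F ∨ NWU F) {x : ℝ} (hx : 0 ≤ x) :
    |(1 - cdf F x) - Real.exp (-(mu * x))| ≤ δ := by
  set R : ℝ → ℝ := fun x => 1 - cdf F x with hR
  have hRanti : Antitone R := antitone_one_sub_cdf F
  have hR0 : ∀ x, 0 ≤ R x := fun x => sub_nonneg.2 (cdf_le_one F x)
  have hpos : 0 ≤ᵐ[F] fun x : ℝ => x := by
    rw [Filter.EventuallyLE, ae_iff]
    simp only [Pi.zero_apply, not_le]
    exact hF
  have htail : ∫ t in Set.Ioi (0 : ℝ), R t = 1 / mu := by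
    rw [← hmean, hint.integral_eq_integral_meas_lt hpos]
    refine setIntegral_congr_fun measurableSet_Ioi fun t _ => ?_
    exact (measureReal_Ioi F t).symm
  -- A nonintegrable function has integral 0 by convention, whereas the value here is 1 / μ > 0.
  have hRint : IntegrableOn R (Set.Ioi 0) := by
    by_contra hcon
    rw [integral_undef hcon] at htail
    have : 0 < 1 / mu := by positivity
    exact this.ne htail
  -- H is the tail of the equilibrium law of F. As R is only right continuous, it is differentiated
  -- from the right.
  set H : ℝ → ℝ := fun x => 1 - mu * ∫ u in (0 : ℝ)..x, R u with hH
  have hRii : ∀ a b, IntervalIntegrable R volume a b := fun a b => hRanti.intervalIntegrable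
  have hcont : Continuous H :=
    continuous_const.sub (continuous_const.mul (intervalIntegral.continuous_primitive hRii 0))
  have hH0 : H 0 = 1 := by simp [hH]
  have hderiv : ∀ x, 0 ≤ x → HasDerivWithinAt H (-(mu * R x)) (Set.Ici x) x := by
    intro x _
    have hc : ContinuousWithinAt R (Set.Ioi x) x :=
      (continuousWithinAt_const.sub ((cdf F).right_continuous x)).mono Set.Ioi_subset_Ici_self
    have h1 := intervalIntegral.integral_hasDerivWithinAt_right (hRii 0 x) (s := Set.Ici x)
      (t := Set.Ioi x) (hRanti.measurable.stronglyMeasurable.stronglyMeasurableAtFilter) hc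
    exact (h1.const_mul mu).const_sub 1
  have hpre : ∀ x : ℝ, (fun y => y + x) ⁻¹' Set.Ioi x = Set.Ioi 0 := by
    intro x
    ext y
    simp
  have hHtail : ∀ x, 0 ≤ x → H x = mu * ∫ y in Set.Ioi (0 : ℝ), R (y + x) := by
    intro x hx
    have h1 := (measurePreserving_add_right volume x).setIntegral_preimage_emb
      (measurableEmbedding_addRight x) R (Set.Ioi x)
    rw [hpre] at h1
    have h2 := intervalIntegral.integral_interval_add_Ioi hRint
      (hRint.mono_set (Set.Ioi_subset_Ioi hx))
    rw [htail] at h2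
    rw [h1]
    simp only [hH]
    have h3 : ∫ u in (0 : ℝ)..x, R u = 1 / mu - ∫ u in Set.Ioi x, R u := by linarith
    rw [h3]
    field_simp
    ring
  have hshift : ∀ x, 0 ≤ x → IntegrableOn (fun y => R (y + x)) (Set.Ioi 0) := by
    intro x hx
    have h1 := ((measurePreserving_add_right volume x).integrableOn_comp_preimage
      (measurableEmbedding_addRight x) (f := R) (s := Set.Ioi x)).2
      (hRint.mono_set (Set.Ioi_subset_Ioi hx))
    rwa [hpre] at h1
  -- The key identity: the integrand measures the failure of the lack-of-memory property. It is
  -- bounded by δ R(y) and has a constant sign under NBU or NWU.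
  have hdiff : ∀ x, 0 ≤ x →
      R x - H x = mu * ∫ y in Set.Ioi (0 : ℝ), (R x * R y - R (y + x)) := by
    intro x hx
    rw [integral_sub (hRint.const_mul _) (hshift x hx), integral_const_mul, htail, hHtail x hx]
    field_simp
  have hdiff_int : ∀ x, 0 ≤ x → IntegrableOn (fun y => R x * R y - R (y + x)) (Set.Ioi 0) :=
    fun x hx => (hRint.const_mul _).sub (hshift x hx)
  have hδR : mu * ∫ y in Set.Ioi (0 : ℝ), δ * R y = δ := by
    rw [integral_const_mul, htail]
    field_simp
  have hbound : ∀ x y, 0 ≤ x → 0 ≤ y → |R x * R y - R (y + x)| ≤ δ * R y := by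
    intro x y hx hy
    rw [add_comm y x]
    exact abs_mul_sub_le_of_residual hδ hx hy
  have hup : ∀ x, 0 ≤ x → R x ≤ H x + δ := by
    intro x hx
    have : R x - H x ≤ δ := by
      rw [hdiff x hx, ← hδR]
      refine mul_le_mul_of_nonneg_left ?_ hmu.le
      exact setIntegral_mono_on (hdiff_int x hx) (hRint.const_mul _) measurableSet_Ioi
        fun y hy => (abs_le.1 (hbound x y hx (le_of_lt hy))).2
    linarith
  have hlow : ∀ x, 0 ≤ x → H x - δ ≤ R x := by
    intro x hx
    have : -δ ≤ R x - H x := by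
      rw [hdiff x hx, ← hδR, ← mul_neg, ← integral_neg]
      refine mul_le_mul_of_nonneg_left ?_ hmu.le
      exact setIntegral_mono_on (hRint.const_mul δ).neg (hdiff_int x hx) measurableSet_Ioi
        fun y hy => (abs_le.1 (hbound x y hx (le_of_lt hy))).1
    linarith
  have he0 := Real.exp_pos (-(mu * x))
  have he1 : Real.exp (-(mu * x)) ≤ 1 := Real.exp_le_one_iff.2 (by nlinarith)
  rw [abs_le]
  -- The sign makes one of the two comparisons of R with H exact, so the errors from R - H and from
  -- H - e^{-μx} do not add up to 2δ.
  rcases h with h | h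
  · have hge : ∀ x, 0 ≤ x → H x - 0 ≤ R x := by
      intro x hx
      have : 0 ≤ R x - H x := by
        rw [hdiff x hx]
        refine mul_nonneg hmu.le (setIntegral_nonneg measurableSet_Ioi fun y hy => ?_)
        have := h x y hx (le_of_lt hy)
        rw [add_comm x y] at this
        exact sub_nonneg.2 this
      linarith
    have h1 := le_exp_add_of_rightDeriv hmu hcont hH0 hderiv hge hx
    have h2 := exp_sub_le_of_rightDeriv hmu hcont hH0 hderiv hup hx
    have h3 := hge x hx
    have h4 := hup x hx
    constructor <;> nlinarith
  · have hge : ∀ x, 0 ≤ x → R x ≤ H x + 0 := by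
      intro x hx
      have : 0 ≤ H x - R x := by
        rw [← neg_sub, hdiff x hx, ← mul_neg, ← integral_neg]
        refine mul_nonneg hmu.le (setIntegral_nonneg measurableSet_Ioi fun y hy => ?_)
        have := h x y hx (le_of_lt hy)
        rw [add_comm x y] at this
        rw [neg_sub]
        exact sub_nonneg.2 this
      linarith
    have h1 := le_exp_add_of_rightDeriv hmu hcont hH0 hderiv hlow hx
    have h2 := exp_sub_le_of_rightDeriv hmu hcont hH0 hderiv hge hx
    have h3 := hge x hx
    have h4 := hlow x hx
    constructor <;> nlinarith

end Equilibrium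

/-! ### Mixed Poisson laws -/

section MixedPoisson

/-- The mixed Poisson law with mixing law `G` and rate `lam`. -/
noncomputable def mixedPoisson (lam : ℝ) (G : Measure ℝ) [IsProbabilityMeasure G] : PMF ℕ :=
  ⟨fun k => ∫⁻ s, poissonMeasure (lam.toNNReal * s.toNNReal) {k} ∂G, by
    rw [ENNReal.summable.hasSum_iff, ← lintegral_tsum
      (f := fun k (s : ℝ) => poissonMeasure (lam.toNNReal * s.toNNReal) {k}) fun k =>
      ((continuous_poissonMeasure_singleton k).measurable.comp
        (measurable_real_toNNReal.const_mul _)).aemeasurable]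
    have h : ∀ r : ℝ≥0, ∑' k, poissonMeasure r {k} = 1 := fun r => by
      simpa only [Measure.toPMF_apply] using (poissonMeasure r).toPMF.tsum_coe
    simp [h]⟩

theorem mixedPoisson_apply (lam : ℝ) (G : Measure ℝ) [IsProbabilityMeasure G] (k : ℕ) :
    mixedPoisson lam G k = ∫⁻ s, poissonMeasure (lam.toNNReal * s.toNNReal) {k} ∂G := rfl

variable {lam : ℝ} {G : Measure ℝ} [IsProbabilityMeasure G]

theorem mixedPoisson_tail (hlam : 0 < lam) (hG : G (Set.Iio 0) = 0) (k : ℕ) :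
    ∑' r, mixedPoisson lam G (k + 1 + r) = erlangIntegral lam k fun u => G (Set.Ioi u) :=
  lintegral_poisson_tail hlam G hG k

theorem mixedPoisson_zero_add (lam : ℝ) (G : Measure ℝ) [IsProbabilityMeasure G] :
    mixedPoisson lam G 0 + ∑' r, mixedPoisson lam G (0 + 1 + r) = 1 := by
  rw [← (mixedPoisson lam G).tsum_coe, tsum_eq_zero_add' (f := mixedPoisson lam G) ENNReal.summable]
  simp only [zero_add, add_comm]

theorem mixedPoisson_eq_ofReal (hlam : 0 < lam) (hG : G (Set.Iio 0) = 0) (k : ℕ) :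
    mixedPoisson lam G k = ENNReal.ofReal (∫ x in Set.Ici (0 : ℝ), poissonWeight lam k x ∂G) := by
  have hpos : ∀ᵐ s ∂G, s ∈ Set.Ici (0 : ℝ) := by
    rw [ae_iff]
    simp only [Set.mem_Ici, not_le]
    exact hG
  rw [Measure.restrict_eq_self_of_ae_mem hpos, ofReal_integral_eq_lintegral_ofReal,
    mixedPoisson_apply]
  · refine lintegral_congr_ae ?_
    filter_upwards [hpos] with s hs
    exact poissonMeasure_eq_ofReal hlam hs k
  · refine Integrable.mono' (integrable_const 1)
      (continuous_poissonWeight lam k).aestronglyMeasurable ?_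
    filter_upwards [hpos] with s hs
    have h0 : ∀ k, 0 ≤ poissonWeight lam k s := fun k => poissonWeight_nonneg hlam k hs
    rw [Real.norm_of_nonneg (h0 k)]
    exact le_hasSum (hasSum_poissonWeight hlam hs) k fun j _ => h0 j
  · filter_upwards [hpos] with s hs
    exact poissonWeight_nonneg hlam k hs

theorem IsMixedPoisson.eq_mixedPoisson {sig : PMF ℕ} (h : IsMixedPoisson sig lam G)
    (hlam : 0 < lam) (hG : G (Set.Iio 0) = 0) : sig = mixedPoisson lam G := by
  ext k
  rw [mixedPoisson_eq_ofReal hlam hG, ← ENNReal.ofReal_toReal (sig.apply_ne_top k), h k]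
  rfl

end MixedPoisson

/-! ### The offspring law and its generating function -/

section Offspring

/-- The geometric law `k ↦ (1 - b) ^ k b`. -/
noncomputable def geometric (b : ℝ) (hb : 0 < b) (hb1 : b ≤ 1) : PMF ℕ :=
  ⟨fun k => ENNReal.ofReal ((1 - b) ^ k * b), by
    have h : HasSum (fun k => (1 - b) ^ k * b) 1 := by
      have h1 := (hasSum_geometric_of_lt_one (sub_nonneg.2 hb1) (sub_lt_self 1 hb)).mul_right b
      rwa [sub_sub_cancel, inv_mul_cancel₀ hb.ne'] at h1
    have h0 : ∀ k, 0 ≤ (1 - b) ^ k * b := fun k =>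
      mul_nonneg (pow_nonneg (sub_nonneg.2 hb1) k) hb.le
    rw [ENNReal.summable.hasSum_iff, ← ENNReal.ofReal_tsum_of_nonneg h0 h.summable, h.tsum_eq,
      ENNReal.ofReal_one]⟩

theorem geometric_apply (b : ℝ) (hb : 0 < b) (hb1 : b ≤ 1) (k : ℕ) :
    geometric b hb hb1 k = ENNReal.ofReal ((1 - b) ^ k * b) := rfl

/-- Lack of memory of the geometric law, in the form required by `expect_randomSum_of_shift`. -/
theorem expect_geometric (b : ℝ) (hb : 0 < b) (hb1 : b ≤ 1) (f : ℕ → ℝ≥0∞) :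
    expect (geometric b hb hb1) f = ENNReal.ofReal b * f 0 +
      ENNReal.ofReal (1 - b) * expect (geometric b hb hb1) fun k => f (k + 1) := by
  rw [expect, tsum_eq_zero_add' ENNReal.summable, expect, ← ENNReal.tsum_mul_left]
  simp only [geometric_apply, pow_zero, one_mul, ← mul_assoc]
  congr 1
  refine tsum_congr fun k => ?_
  rw [← ENNReal.ofReal_mul (sub_nonneg.2 hb1)]
  ring_nf

/-- The law which gives mass `1 - d` to `0` and is geometric on the positive integers. -/
noncomputable def offspring (b : ℝ) (hb : 0 < b) (hb1 : b ≤ 1) (d : ℝ) (hd : 0 ≤ d) (hd1 : d ≤ 1) :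
    PMF ℕ :=
  ⟨fun k => Nat.casesOn k (ENNReal.ofReal (1 - d)) fun j => ENNReal.ofReal d * geometric b hb hb1 j,
    by
      rw [ENNReal.summable.hasSum_iff, tsum_eq_zero_add' ENNReal.summable]
      change ENNReal.ofReal (1 - d) + ∑' j, ENNReal.ofReal d * geometric b hb hb1 j = 1
      rw [ENNReal.tsum_mul_left, PMF.tsum_coe, mul_one,
        ← ENNReal.ofReal_add (sub_nonneg.2 hd1) hd, sub_add_cancel, ENNReal.ofReal_one]⟩

variable {b : ℝ} (hb : 0 < b) (hb1 : b ≤ 1) {d : ℝ} (hd : 0 ≤ d) (hd1 : d ≤ 1)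

theorem offspring_zero : offspring b hb hb1 d hd hd1 0 = ENNReal.ofReal (1 - d) := rfl

theorem offspring_succ (k : ℕ) : offspring b hb hb1 d hd hd1 (k + 1) =
    ENNReal.ofReal d * geometric b hb hb1 k := rfl

theorem expect_offspring (f : ℕ → ℝ≥0∞) :
    expect (offspring b hb hb1 d hd hd1) f = ENNReal.ofReal (1 - d) * f 0 +
      ENNReal.ofReal d * expect (geometric b hb hb1) fun k => f (k + 1) := by
  rw [expect, tsum_eq_zero_add' ENNReal.summable, expect, ← ENNReal.tsum_mul_left]
  simp only [offspring_zero, offspring_succ, mul_assoc]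

theorem one_sub_add_mul_ne_zero {b : ℝ} (hb : 0 < b) (hb1 : b ≤ 1) {z : ℂ} (hz : ‖z‖ ≤ 1) :
    ‖((1 - b : ℝ) : ℂ) * z‖ < 1 ∧ 1 - z + z * (b : ℂ) ≠ 0 := by
  have h1 : ‖((1 - b : ℝ) : ℂ) * z‖ < 1 := by
    rw [norm_mul, Complex.norm_real, Real.norm_of_nonneg (sub_nonneg.2 hb1)]
    nlinarith [norm_nonneg z]
  refine ⟨h1, fun h => ?_⟩
  have h2 : ((1 - b : ℝ) : ℂ) * z = 1 := by
    push_cast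
    linear_combination -h
  rw [h2, norm_one] at h1
  exact lt_irrefl _ h1

theorem pgf_offspring {z : ℂ} (hz : ‖z‖ ≤ 1) :
    pgf (offspring b hb hb1 d hd hd1) z =
      ((1 - d : ℝ) : ℂ) + d * b * z / (1 - z + z * b) := by
  obtain ⟨h1, h2⟩ := one_sub_add_mul_ne_zero hb hb1 hz
  have h3 : HasSum (fun k : ℕ => (d * b * z : ℂ) * (((1 - b : ℝ) : ℂ) * z) ^ k)
      (d * b * z / (1 - z + z * b)) := by
    have := (hasSum_geometric_of_norm_lt_one h1).mul_left (d * b * z : ℂ)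
    rwa [show 1 - ((1 - b : ℝ) : ℂ) * z = 1 - z + z * b by push_cast; ring, ← div_eq_mul_inv] at this
  have h4 : ∀ k : ℕ, (((offspring b hb hb1 d hd hd1 (k + 1)).toReal : ℝ) : ℂ) * z ^ (k + 1) =
      (d * b * z : ℂ) * (((1 - b : ℝ) : ℂ) * z) ^ k := by
    intro k
    rw [offspring_succ, geometric_apply, ENNReal.toReal_mul, ENNReal.toReal_ofReal hd,
      ENNReal.toReal_ofReal (mul_nonneg (pow_nonneg (sub_nonneg.2 hb1) k) hb.le)]
    push_cast
    rw [mul_pow]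
    ring
  unfold pgf
  change ∑' m : ℕ, (((offspring b hb hb1 d hd hd1 m).toReal : ℝ) : ℂ) * z ^ m = _
  rw [tsum_eq_zero_add' (by simp only [h4]; exact h3.summable)]
  simp only [h4]
  rw [h3.tsum_eq, offspring_zero, ENNReal.toReal_ofReal (sub_nonneg.2 hd1), pow_zero, mul_one]

theorem ofReal_pgf (q : PMF ℕ) (z : ℝ) : ((pgf q z : ℝ) : ℂ) = pgf q (z : ℂ) := by
  unfold pgf
  rw [Complex.ofReal_tsum]
  refine tsum_congr fun m => ?_
  simp

/-- With g* = b / (1 - z + z b), the difference factors exactly as (1 - d - b)(1 - z g*). -/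
theorem norm_pgf_offspring_sub_lt {η : ℝ} (h : |1 - d - b| < η) {z : ℂ} (hz : ‖z‖ ≤ 1) :
    ‖pgf (offspring b hb hb1 d hd hd1) z - (b : ℂ) / (1 - z + z * (b : ℂ))‖ <
      η * (1 + ‖z‖ * ‖(b : ℂ) / (1 - z + z * (b : ℂ))‖) := by
  have h2 := (one_sub_add_mul_ne_zero hb hb1 hz).2
  have h3 : pgf (offspring b hb hb1 d hd hd1) z - (b : ℂ) / (1 - z + z * (b : ℂ)) =
      ((1 - d - b : ℝ) : ℂ) * (1 - z * ((b : ℂ) / (1 - z + z * (b : ℂ)))) := by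
    rw [pgf_offspring hb hb1 hd hd1 hz]
    push_cast
    obtain ⟨D, hD⟩ : ∃ D, D = 1 - z + z * (b : ℂ) := ⟨_, rfl⟩
    rw [← hD] at h2 ⊢
    field_simp
    rw [hD]
    ring
  rw [h3, norm_mul, Complex.norm_real, Real.norm_eq_abs]
  have h4 : ‖1 - z * ((b : ℂ) / (1 - z + z * (b : ℂ)))‖ ≤
      1 + ‖z‖ * ‖(b : ℂ) / (1 - z + z * (b : ℂ))‖ := by
    refine (norm_sub_le _ _).trans ?_
    rw [norm_one, norm_mul]
  have h5 : 0 < 1 + ‖z‖ * ‖(b : ℂ) / (1 - z + z * (b : ℂ))‖ := by positivity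
  exact (mul_le_mul_of_nonneg_left h4 (abs_nonneg _)).trans_lt (mul_lt_mul_of_pos_right h h5)

theorem pgf_offspring_lt {η : ℝ} (h : |1 - d - b| < η) {z : ℝ} (hz : 0 ≤ z) (hz1 : z ≤ 1) :
    pgf (offspring b hb hb1 d hd hd1) z <
      b / (1 - z + z * b) + η * ((1 - z + 2 * z * b) / (1 - z + z * b)) := by
  have hz' : ‖(z : ℂ)‖ ≤ 1 := by rwa [Complex.norm_real, Real.norm_of_nonneg hz]
  have h1 := norm_pgf_offspring_sub_lt hb hb1 hd hd1 h hz'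
  have hD : 0 < 1 - z + z * b := by
    rcases hz.eq_or_lt with rfl | h0
    · norm_num
    · have := mul_pos h0 hb
      linarith
  rw [← ofReal_pgf, show (b : ℂ) / (1 - (z : ℂ) + z * (b : ℂ)) =
      ((b / (1 - z + z * b) : ℝ) : ℂ) by push_cast; rfl, ← Complex.ofReal_sub, Complex.norm_real,
    Complex.norm_real, Complex.norm_real, Real.norm_eq_abs, Real.norm_of_nonneg hz,
    Real.norm_of_nonneg (by positivity)] at h1
  have h2 := (abs_lt.1 h1).2
  have h3 : (1 - z + 2 * z * b) / (1 - z + z * b) = 1 + z * (b / (1 - z + z * b)) := by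
    field_simp
    ring
  rw [h3]
  linarith

end Offspring

/-! ### Bounds for the service law -/

section Service

variable {lam mu eps y₀ : ℝ} {B F : Measure ℝ}

theorem ConditionA.one_sub_cdf (h : ConditionA B F (1 / 2) mu eps) {x : ℝ} (hx : 0 ≤ x) :
    1 - cdf B x = 1 / 2 * (1 - cdf F x) + 1 / 2 * Real.exp (-(mu * x)) := by
  rw [h.repr x hx, expCdf]
  ring

variable [IsProbabilityMeasure B]

theorem ConditionA.measure_Iio (h : ConditionA B F (1 / 2) mu eps) : B (Set.Iio 0) = 0 := by
  refine measure_mono_null Set.Iio_subset_Iic_self ?_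
  rw [← ofReal_cdf, h.service_zero, ENNReal.ofReal_zero]

variable [IsProbabilityMeasure F]

theorem ConditionA.measure_Ioi (h : ConditionA B F (1 / 2) mu eps) {x : ℝ} (hx : 0 ≤ x) :
    B (Set.Ioi x) = ENNReal.ofReal (1 / 2) * F (Set.Ioi x) +
      ENNReal.ofReal (1 / 2) * ENNReal.ofReal (Real.exp (-(mu * x))) := by
  have h0 : 0 ≤ 1 - cdf F x := sub_nonneg.2 (cdf_le_one F x)
  rw [LossQueue.measure_Ioi, h.one_sub_cdf hx, ENNReal.ofReal_add (by positivity) (by positivity),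
    ENNReal.ofReal_mul (by norm_num), ENNReal.ofReal_mul (by norm_num), LossQueue.measure_Ioi]

/-- Lower bound for the law of the number of arrivals during a residual service time. -/
theorem ConditionA.measure_Ioi_mul_le (h : ConditionA B F (1 / 2) mu eps) (hlam : 0 < lam)
    (hD : ConditionD F lam y₀) (m : ℕ) {c : ℝ≥0∞}
    (hcF : c ≤ erlangIntegral lam m fun x => ENNReal.ofReal (1 - residual F y₀ x))
    (hcE : c ≤ erlangIntegral lam m fun x => ENNReal.ofReal (Real.exp (-(mu * x))))
    {y : ℝ} (hy : 0 ≤ y) :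
    B (Set.Ioi y) * c ≤ erlangIntegral lam m fun x => B (Set.Ioi (x + y)) := by
  have hmF : Measurable fun x => F (Set.Ioi (x + y)) :=
    Antitone.measurable fun _ _ h => measure_mono (Set.Ioi_subset_Ioi (by linarith))
  have hmE : Measurable fun x => ENNReal.ofReal (Real.exp (-(mu * x))) := by fun_prop
  have h1 : (erlangIntegral lam m fun x => B (Set.Ioi (x + y))) =
      ENNReal.ofReal (1 / 2) * (erlangIntegral lam m fun x => F (Set.Ioi (x + y))) +
        ENNReal.ofReal (1 / 2) * (ENNReal.ofReal (Real.exp (-(mu * y))) *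
          erlangIntegral lam m fun x => ENNReal.ofReal (Real.exp (-(mu * x)))) := by
    rw [← erlangIntegral_const_mul m _ hmF, ← erlangIntegral_const_mul m _ hmE,
      ← erlangIntegral_const_mul m _ (hmE.const_mul _), ← erlangIntegral_add m (hmF.const_mul _)]
    refine erlangIntegral_congr m fun x hx => ?_
    rw [h.measure_Ioi (add_nonneg hx.le hy), ← ENNReal.ofReal_mul (Real.exp_nonneg _),
      ← Real.exp_add]
    ring_nf
  -- The exponential part of B keeps its shape at every age; for the F part the least residual
  -- F_{y₀} bounds all others.
  have h2 : F (Set.Ioi y) * c ≤ erlangIntegral lam m fun x => F (Set.Ioi (x + y)) := by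
    by_cases hr : Reachable F y
    · have h3 : (erlangIntegral lam m fun x => F (Set.Ioi (x + y))) = F (Set.Ioi y) *
          erlangIntegral lam m fun x => ENNReal.ofReal (1 - residual F y x) := by
        rw [← erlangIntegral_const_mul m _
          ((monotone_residual F y).measurable.const_sub 1).ennreal_ofReal]
        refine erlangIntegral_congr m fun x hx => ?_
        rw [LossQueue.measure_Ioi, one_sub_cdf_add hr hx.le,
          ENNReal.ofReal_mul (sub_nonneg.2 (cdf_le_one F y)), LossQueue.measure_Ioi]
      rw [h3]
      refine mul_le_mul_right (hcF.trans ?_) _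
      exact erlangIntegral_le_of_leC hlam (monotone_residual F y₀).measurable
        (monotone_residual F y).measurable (fun x _ => residual_mem_Icc F y₀ x)
        (fun x _ => residual_mem_Icc F y x) (hD.least y hr) m
    · rw [measure_Ioi_eq_zero_of_not_reachable hy hr, zero_mul]
      exact zero_le
  rw [h1, h.measure_Ioi hy, add_mul, mul_assoc, mul_assoc]
  gcongr

/-- Given at least k arrivals, the remaining service is a residual at the age of arrival number k
(age 0 if k = 0); c bounds the chance of m + 1 more arrivals uniformly in that age. -/
theorem ConditionA.tail_mul_le (h : ConditionA B F (1 / 2) mu eps) (hlam : 0 < lam)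
    (hD : ConditionD F lam y₀) (m : ℕ) {c : ℝ≥0∞}
    (hcF : c ≤ erlangIntegral lam m fun x => ENNReal.ofReal (1 - residual F y₀ x))
    (hcE : c ≤ erlangIntegral lam m fun x => ENNReal.ofReal (Real.exp (-(mu * x)))) (k : ℕ) :
    (∑' r, mixedPoisson lam B (k + r)) * c ≤ ∑' r, mixedPoisson lam B (k + (m + 1 + r)) := by
  have hB0 := h.measure_Iio
  cases k with
  | zero =>
    simp only [zero_add, PMF.tsum_coe, one_mul]
    rw [mixedPoisson_tail hlam hB0]
    have h1 := h.measure_Ioi_mul_le hlam hD m hcF hcE le_rfl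
    rw [LossQueue.measure_Ioi, h.service_zero, sub_zero, ENNReal.ofReal_one, one_mul] at h1
    simpa only [add_zero] using h1
  | succ k =>
    have h1 : ∀ r, k + 1 + (m + 1 + r) = k + m + 1 + 1 + r := fun r => by omega
    simp only [h1]
    have hm : Measurable fun x => B (Set.Ioi x) :=
      Antitone.measurable fun _ _ h => measure_mono (Set.Ioi_subset_Ioi h)
    rw [mixedPoisson_tail hlam hB0, mixedPoisson_tail hlam hB0, ← erlangIntegral_conv hlam k m hm,
      mul_comm, ← erlangIntegral_const_mul k c hm]
    refine erlangIntegral_mono k fun y hy => ?_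
    rw [mul_comm]
    exact h.measure_Ioi_mul_le hlam hD m hcF hcE hy.le

/-- The Erlang density has mass one, so a uniform error δ passes to the integrals unchanged. -/
theorem erlangIntegral_toReal_le (hlam : 0 < lam) {f g : ℝ → ℝ} {δ : ℝ} (hδ : 0 ≤ δ)
    (hg : Measurable g) (hg1 : ∀ x, 0 < x → g x ≤ 1) (hfg : ∀ x, 0 < x → f x ≤ g x + δ) (k : ℕ) :
    (erlangIntegral lam k fun x => ENNReal.ofReal (f x)).toReal ≤
      (erlangIntegral lam k fun x => ENNReal.ofReal (g x)).toReal + δ := by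
  have h1 : (erlangIntegral lam k fun x => ENNReal.ofReal (f x)) ≤
      (erlangIntegral lam k fun x => ENNReal.ofReal (g x)) + ENNReal.ofReal δ := by
    rw [← erlangIntegral_const hlam k (ENNReal.ofReal δ), ← erlangIntegral_add k hg.ennreal_ofReal]
    exact erlangIntegral_mono k fun x hx =>
      (ENNReal.ofReal_le_ofReal (hfg x hx)).trans ENNReal.ofReal_add_le
  have h2 : (erlangIntegral lam k fun x => ENNReal.ofReal (g x)) ≠ ∞ :=
    ne_top_of_le_ne_top ENNReal.one_ne_top
      (erlangIntegral_le_one hlam k fun x hx => ENNReal.ofReal_le_one.2 (hg1 x hx))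
  have h3 := ENNReal.toReal_mono (ENNReal.add_ne_top.2 ⟨h2, ENNReal.ofReal_ne_top⟩) h1
  rwa [ENNReal.toReal_add h2 ENNReal.ofReal_ne_top, ENNReal.toReal_ofReal hδ] at h3

theorem ConditionB.abs_residual_sub_cdf_le (h : ConditionB B F (1 / 2) mu eps) (hmu : 0 < mu)
    {δ : ℝ} (hδ0 : 0 ≤ δ)
    (hδ : ∀ x y : ℝ, 0 ≤ x → Reachable F y → |residual F y x - cdf F x| ≤ δ)
    {x y : ℝ} (hx : 0 ≤ x) (hy : 0 ≤ y) : |residual B y x - cdf B x| ≤ 3 * δ / 2 := by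
  have hA := h.toConditionA
  -- The exponential component makes every age reachable for B.
  have hby : 0 < 1 - cdf B y := by
    rw [hA.one_sub_cdf hy]
    have h1 := cdf_le_one F y
    have h2 := Real.exp_pos (-(mu * y))
    linarith
  have hr : Reachable B y := ⟨hy, by
    rw [LossQueue.measure_Ioi]
    exact (ENNReal.ofReal_pos.2 hby).ne'⟩
  have h1 := one_sub_cdf_add hr hx
  have h2 := abs_le.1 (abs_mul_sub_le_of_residual hδ hx hy)
  have h3 := abs_le.1 (abs_cdf_sub_expCdf_le hmu hA.nonneg hA.integrable hA.mean hδ0 hδ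
    h.nbu_or_nwu hx)
  have hFy : 0 ≤ 1 - cdf F y := sub_nonneg.2 (cdf_le_one F y)
  have hs := Real.exp_pos (-(mu * y))
  have hes : Real.exp (-(mu * (x + y))) = Real.exp (-(mu * x)) * Real.exp (-(mu * y)) := by
    rw [← Real.exp_add]
    ring_nf
  have h4 : (residual B y x - cdf B x) * (1 - cdf B y) =
      (1 - cdf B x) * (1 - cdf B y) - (1 - cdf B (x + y)) := by
    rw [h1]
    ring
  -- Write R for the tail of F and e for that of E_μ. The quantity equals ½(R(x)R(y) - R(x+y)) +
  -- ¼(e(x) - R(x))R(y) + ¼(R(x) - e(x))e(y), hence is at most ¾δ R(y) + ¼δ e(y).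
  have h5 : |(residual B y x - cdf B x) * (1 - cdf B y)| ≤ 3 * δ / 2 * (1 - cdf B y) := by
    rw [h4, hA.one_sub_cdf hx, hA.one_sub_cdf hy, hA.one_sub_cdf (add_nonneg hx hy), hes, abs_le]
    have h6 := mul_le_mul_of_nonneg_right h3.1 hFy
    have h7 := mul_le_mul_of_nonneg_right h3.2 hFy
    have h8 := mul_le_mul_of_nonneg_right h3.1 hs.le
    have h9 := mul_le_mul_of_nonneg_right h3.2 hs.le
    have h10 := mul_nonneg hδ0 hs.le
    constructor <;> nlinarith
  rw [abs_mul, abs_of_pos hby] at h5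
  exact le_of_mul_le_mul_right h5 hby

end Service

/-! ### The probability of no arrival during a service -/

section Constants

theorem bHat_pos {lam mu : ℝ} {F : Measure ℝ} (hlam : 0 < lam) (hmu : 0 < mu) : 0 < bHat F (1 / 2) mu lam := by
  have h1 : 0 ≤ ∫ x in Set.Ici (0 : ℝ), Real.exp (-(lam * x)) ∂F :=
    setIntegral_nonneg measurableSet_Ici fun x _ => (Real.exp_nonneg _)
  have h2 : 0 < mu / (mu + lam) := by positivity
  unfold bHat
  linarith

variable {lam mu eps : ℝ} {B F : Measure ℝ} [IsProbabilityMeasure B] [IsProbabilityMeasure F]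

theorem toReal_erlangIntegral_zero {G : Measure ℝ} [IsProbabilityMeasure G] (hlam : 0 < lam)
    (hG : G (Set.Iio 0) = 0) :
    (erlangIntegral lam 0 fun x => G (Set.Ioi x)).toReal =
      1 - ∫ x in Set.Ici (0 : ℝ), Real.exp (-(lam * x)) ∂G := by
  have h := mixedPoisson_zero_add lam G
  rw [mixedPoisson_tail hlam hG, mixedPoisson_eq_ofReal hlam hG] at h
  have hne : (erlangIntegral lam 0 fun x => G (Set.Ioi x)) ≠ ∞ :=
    ne_top_of_le_ne_top ENNReal.one_ne_top (h ▸ le_add_self)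
  have h1 := congrArg ENNReal.toReal h
  have hnn : 0 ≤ ∫ x in Set.Ici (0 : ℝ), poissonWeight lam 0 x ∂G :=
    setIntegral_nonneg measurableSet_Ici fun x hx => poissonWeight_nonneg hlam 0 hx
  rw [ENNReal.toReal_add ENNReal.ofReal_ne_top hne, ENNReal.toReal_ofReal hnn,
    ENNReal.toReal_one] at h1
  have h2 : ∀ x, poissonWeight lam 0 x = Real.exp (-(lam * x)) := fun x => by simp [poissonWeight]
  simp only [h2] at h1
  linarith

/-- Identifies B̂ with the Laplace transform of B, by comparing the probabilities of an arrival
before the end of a service. -/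
theorem ConditionA.bHat_eq (h : ConditionA B F (1 / 2) mu eps) (hlam : 0 < lam) (hmu : 0 < mu) :
    bHat F (1 / 2) mu lam = ∫ x in Set.Ici (0 : ℝ), Real.exp (-(lam * x)) ∂B := by
  have h1 := toReal_erlangIntegral_zero hlam h.measure_Iio
  have h2 := toReal_erlangIntegral_zero hlam h.nonneg
  have hmF : Measurable fun x => F (Set.Ioi x) :=
    Antitone.measurable fun _ _ h => measure_mono (Set.Ioi_subset_Ioi h)
  have hF1 : (erlangIntegral lam 0 fun x => F (Set.Ioi x)) ≠ ∞ :=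
    ne_top_of_le_ne_top ENNReal.one_ne_top (erlangIntegral_le_one hlam 0 fun _ _ => prob_le_one)
  have h3 : (erlangIntegral lam 0 fun x => B (Set.Ioi x)) =
      ENNReal.ofReal (1 / 2) * (erlangIntegral lam 0 fun x => F (Set.Ioi x)) +
        ENNReal.ofReal (1 / 2) * ENNReal.ofReal (lam / (lam + mu)) := by
    rw [← erlangIntegral_zero_exp hlam hmu, ← erlangIntegral_const_mul 0 _ hmF,
      ← erlangIntegral_const_mul 0 _ (by fun_prop), ← erlangIntegral_add 0 (hmF.const_mul _)]
    exact erlangIntegral_congr 0 fun x hx => h.measure_Ioi hx.le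
  rw [h3, ENNReal.toReal_add (ENNReal.mul_ne_top ENNReal.ofReal_ne_top hF1)
    (ENNReal.mul_ne_top ENNReal.ofReal_ne_top ENNReal.ofReal_ne_top), ENNReal.toReal_mul,
    ENNReal.toReal_mul, h2, ENNReal.toReal_ofReal (by norm_num),
    ENNReal.toReal_ofReal (by positivity)] at h1
  have h4 : lam / (lam + mu) = 1 - mu / (mu + lam) := by
    field_simp
    ring
  rw [h4] at h1
  rw [bHat]
  linarith

theorem ConditionA.bHat_le_one (h : ConditionA B F (1 / 2) mu eps) (hlam : 0 < lam) (hmu : 0 < mu) :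
    bHat F (1 / 2) mu lam ≤ 1 := by
  rw [h.bHat_eq hlam hmu]
  have h1 := toReal_erlangIntegral_zero hlam h.measure_Iio
  have h2 : 0 ≤ (erlangIntegral lam 0 fun x => B (Set.Ioi x)).toReal := ENNReal.toReal_nonneg
  linarith

theorem ConditionA.mixedPoisson_zero (h : ConditionA B F (1 / 2) mu eps) (hlam : 0 < lam)
    (hmu : 0 < mu) : mixedPoisson lam B 0 = ENNReal.ofReal (bHat F (1 / 2) mu lam) := by
  rw [mixedPoisson_eq_ofReal hlam h.measure_Iio, h.bHat_eq hlam hmu]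
  simp [poissonWeight]

theorem ConditionA.mixedPoisson_tail_one (h : ConditionA B F (1 / 2) mu eps) (hlam : 0 < lam)
    (hmu : 0 < mu) :
    ∑' r, mixedPoisson lam B (1 + r) = ENNReal.ofReal (1 - bHat F (1 / 2) mu lam) := by
  have h1 := mixedPoisson_zero_add lam B
  have hb := bHat_pos (F := F) hlam hmu
  rw [h.mixedPoisson_zero hlam hmu, zero_add] at h1
  rw [ENNReal.ofReal_sub _ hb.le, ENNReal.ofReal_one, ← h1,
    ENNReal.add_sub_cancel_left ENNReal.ofReal_ne_top]

end Constants

end LossQueue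

/-! ### Assembly of the main theorem -/

theorem mainTheorem5 {Ω : Type*} [MeasurableSpace Ω] (P : Measure Ω) [IsProbabilityMeasure P]
    (n : ℕ) (lam mu eps : ℝ) (hlam : 0 < lam) (hmu : 0 < mu)
    (B F : Measure ℝ) [IsProbabilityMeasure B] [IsProbabilityMeasure F]
    (N : NNReal → Ω → ℕ) (S : ℕ → Ω → ℝ)
    (hqueue : LossQueue.IsMGIInput N S lam B P)
    (hB : LossQueue.ConditionB B F (1 / 2) mu eps)
    (y₀ : ℝ) (hD : LossQueue.ConditionD F lam y₀) :
    (∃ δ < 3 * eps / 2, ∀ x y : ℝ, 0 ≤ x → 0 ≤ y →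
      |LossQueue.residual B y x - ProbabilityTheory.cdf B x| ≤ δ) ∧
    ∃ q : PMF ℕ,
      (∀ z : ℝ, 0 ≤ z → z ≤ 1 →
        LossQueue.pgf q z <
          LossQueue.bHat F (1 / 2) mu lam / (1 - z + z * LossQueue.bHat F (1 / 2) mu lam) +
          3 * eps / 2 *
            ((1 - z + 2 * z * LossQueue.bHat F (1 / 2) mu lam) /
              (1 - z + z * LossQueue.bHat F (1 / 2) mu lam))) ∧
      (∀ z : ℂ, ‖z‖ ≤ 1 →
        ‖LossQueue.pgf q z -
          (LossQueue.bHat F (1 / 2) mu lam : ℂ) /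
            (1 - z + z * (LossQueue.bHat F (1 / 2) mu lam : ℂ))‖ <
          3 * eps / 2 *
            (1 + ‖z‖ * ‖(LossQueue.bHat F (1 / 2) mu lam : ℂ) /
              (1 - z + z * (LossQueue.bHat F (1 / 2) mu lam : ℂ))‖)) ∧
      ∀ (G : Measure ℝ) [IsProbabilityMeasure G], G (Set.Iio 0) = 0 →
        LossQueue.LeC lam (ProbabilityTheory.cdf G) (LossQueue.residual F y₀) →
        LossQueue.LeC lam (ProbabilityTheory.cdf G) (LossQueue.expCdf mu) →
        ∀ sig : PMF ℕ, LossQueue.IsMixedPoisson sig lam G →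
          LossQueue.StochGE P (LossQueue.numLosses n N S)
            (LossQueue.randomSum (LossQueue.galtonWatson q n) sig) := by
  open LossQueue in
  have hA := hB.toConditionA
  obtain ⟨δ, hδeps, hδ⟩ := hB.sup_lt
  have hδ0 : 0 ≤ δ := (abs_nonneg _).trans (hδ 0 y₀ le_rfl hD.reachable)
  refine ⟨⟨3 * δ / 2, by linarith, fun x y hx hy => hB.abs_residual_sub_cdf_le hmu hδ0 hδ hx hy⟩, ?_⟩
  set b := bHat F (1 / 2) mu lam with hbdef
  have hb : 0 < b := bHat_pos hlam hmu
  have hb1 : b ≤ 1 := hA.bHat_le_one hlam hmu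
  -- `tY` and `tE` are the probabilities of an arrival during a time with law F_{y₀} and E_μ; their
  -- minimum d bounds the chance of one more arrival in any residual service.
  set tY := erlangIntegral lam 0 fun x => ENNReal.ofReal (1 - residual F y₀ x) with htY
  set tE := erlangIntegral lam 0 fun x => ENNReal.ofReal (Real.exp (-(mu * x))) with htE
  have htY1 : tY ≤ 1 := erlangIntegral_le_one hlam 0 fun x _ =>
    ENNReal.ofReal_le_one.2 (by linarith [(residual_mem_Icc F y₀ x).1])
  have htEval : tE = ENNReal.ofReal (lam / (lam + mu)) := erlangIntegral_zero_exp hlam hmu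
  have htEr : tE.toReal = lam / (lam + mu) := by
    rw [htEval, ENNReal.toReal_ofReal (by positivity)]
  set d := (min tY tE).toReal with hddef
  have hmin1 : min tY tE ≤ 1 := (min_le_left _ _).trans htY1
  have hmin : min tY tE ≠ ∞ := ne_top_of_le_ne_top ENNReal.one_ne_top hmin1
  have hd : 0 ≤ d := ENNReal.toReal_nonneg
  have hd1 : d ≤ 1 := by
    rw [hddef, ← ENNReal.toReal_one]
    exact ENNReal.toReal_mono ENNReal.one_ne_top hmin1
  have hdE : ENNReal.ofReal d = min tY tE := ENNReal.ofReal_toReal hmin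
  have hdcases : d = tY.toReal ∨ d = tE.toReal := by
    rcases min_choice tY tE with h | h
    · exact Or.inl (by rw [hddef, h])
    · exact Or.inr (by rw [hddef, h])
  set tF := (erlangIntegral lam 0 fun x => ENNReal.ofReal (1 - cdf F x)).toReal with htF
  have hmr : Measurable fun x => 1 - residual F y₀ x :=
    (monotone_residual F y₀).measurable.const_sub 1
  have hmF : Measurable fun x => 1 - cdf F x := (antitone_one_sub_cdf F).measurable
  have hFE : ∀ x, 0 < x → |(1 - cdf F x) - Real.exp (-(mu * x))| ≤ δ := fun x hx =>
    abs_cdf_sub_expCdf_le hmu hA.nonneg hA.integrable hA.mean hδ0 hδ hB.nbu_or_nwu hx.le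
  have h1 : tY.toReal ≤ tF + δ :=
    erlangIntegral_toReal_le hlam hδ0 hmF (fun x _ => by linarith [cdf_nonneg F x])
      (fun x hx => by linarith [(abs_le.1 (hδ x y₀ hx.le hD.reachable)).1]) 0
  have h2 : tF ≤ tY.toReal + δ :=
    erlangIntegral_toReal_le hlam hδ0 hmr (fun x _ => by linarith [(residual_mem_Icc F y₀ x).1])
      (fun x hx => by linarith [(abs_le.1 (hδ x y₀ hx.le hD.reachable)).2]) 0
  have h3 : tE.toReal ≤ tF + δ :=
    erlangIntegral_toReal_le hlam hδ0 hmF (fun x _ => by linarith [cdf_nonneg F x])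
      (fun x hx => by linarith [(abs_le.1 (hFE x hx)).1]) 0
  have h4 : tF ≤ tE.toReal + δ :=
    erlangIntegral_toReal_le hlam hδ0 (by fun_prop)
      (fun x hx => Real.exp_le_one_iff.2 (by nlinarith))
      (fun x hx => by linarith [(abs_le.1 (hFE x hx)).2]) 0
  have hbval : b = 1 / 2 * (1 - tF) + 1 / 2 * (1 - tE.toReal) := by
    have h5 := toReal_erlangIntegral_zero hlam hA.nonneg
    simp only [measure_Ioi] at h5
    have h6 : lam / (lam + mu) = 1 - mu / (mu + lam) := by
      field_simp
      ring
    rw [htEr, h6, htF, h5, hbdef, bHat]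
    ring
  -- Here 1 - b = (tF + tE)/2, while tY and tE both lie within δ of tF. The worst case is d = tY:
  -- half of |tY - tF| ≤ δ plus half of |tY - tE| ≤ 2δ.
  have hη : |1 - d - b| < 3 * eps / 2 := by
    rw [abs_lt]
    rcases hdcases with h | h <;> rw [h, hbval] <;> constructor <;> linarith
  refine ⟨offspring b hb hb1 d hd hd1, fun z hz hz1 => pgf_offspring_lt hb hb1 hd hd1 hη hz hz1,
    fun z hz => norm_pgf_offspring_sub_lt hb hb1 hd hd1 hη hz, ?_⟩
  intro G _ hG0 hGF hGE sig hsig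
  rw [hsig.eq_mixedPoisson hlam hG0]
  have hcdf : ∀ k, (erlangIntegral lam k fun x => G (Set.Ioi x)) =
      erlangIntegral lam k fun x => ENNReal.ofReal (1 - cdf G x) := fun k => by
    simp only [measure_Ioi]
  refine stochGE_of_iid (a := fun k ω => arrivalsDuring N S ω k) (α := mixedPoisson lam B)
    (geo := geometric b hb hb1) (β := ENNReal.ofReal (1 - d)) (d := ENNReal.ofReal d)
    (b := ENNReal.ofReal b) (b' := ENNReal.ofReal (1 - b))
    hqueue.measurable_arrivalsDuring (hqueue.prob_arrivals hA.measure_Iio) n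
    (expect_offspring hb hb1 hd hd1) (expect_geometric b hb hb1) ?_ ?_ ?_
    (hA.mixedPoisson_zero hlam hmu).symm (hA.mixedPoisson_tail_one hlam hmu).symm ?_
  · rw [← ENNReal.ofReal_add (sub_nonneg.2 hd1) hd, sub_add_cancel, ENNReal.ofReal_one]
  · intro k m
    -- For m = 0 the tail of ς is 1. For m + 1 it is an Erlang integral of the tail of G, which the
    -- two order relations place below those of F_{y₀} and E_μ.
    cases m with
    | zero => simp [PMF.tsum_coe]
    | succ m =>
      rw [mixedPoisson_tail hlam hG0, hcdf]
      refine hA.tail_mul_le hlam hD m ?_ ?_ k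
      · exact erlangIntegral_le_of_leC hlam (monotone_cdf G).measurable
          (monotone_residual F y₀).measurable (fun x _ => cdf_mem_Icc G x)
          (fun x _ => residual_mem_Icc F y₀ x) hGF m
      · have h5 := erlangIntegral_le_of_leC hlam (monotone_cdf G).measurable
          (measurable_expCdf mu) (fun x _ => cdf_mem_Icc G x)
          (fun x hx => expCdf_mem_Icc hmu hx.le) hGE m
        simpa only [one_sub_expCdf] using h5
  · intro k
    have h5 := hA.tail_mul_le hlam hD 0 (c := ENNReal.ofReal d) (hdE.le.trans (min_le_left _ _))
      (hdE.le.trans (min_le_right _ _)) k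
    simpa only [zero_add, ← add_assoc] using h5
  · rw [hA.mixedPoisson_zero hlam hmu]
    exact (ENNReal.ofReal_pos.2 hb).ne'
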